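/- **Proposition.** Let $\mathbf B=\{\cdots<\overline 2<\overline 1<1<2<\cdots\}$ with degree $|\overline k|=0$, $|k|=1$ for $k\ge 1$, and let $I=\{\dots,\overline 2,\overline 1,0,1,2,\dots\}$. Let $P=\mathbb Z\Lambda\oplus\bigoplus_{b\in\mathbf B}\mathbb Z\epsilon_b$, with the form $(\epsilon_b,\epsilon_{b'})=(-1)^{|b|}\delta_{bb'}$ on $\bigoplus_b\mathbb Z\epsilon_b$, simple roots $\alpha_{\overline k}=\epsilon_{\overline{k+1}}-\epsilon_{\overline k}$, $\alpha_0=\epsilon_{\overline 1}-\epsilon_1$, $\alpha_k=\epsilon_k-\epsilon_{k+1}$, and simple coroots given by $\langle h_i,\Lambda\rangle=\delta_{0i}$, $\langle h_i,\epsilon_b\rangle=(\alpha_i,\epsilon_b)$ for $i\in\{\dots,\overline 1,0\}$ and $\langle h_i,\epsilon_b\rangle=-(\alpha_i,\epsilon_b)$ for $i\in\{1,2,\dots\}$. Write $\mu\le\nu$ if $\nu-\mu\in\sum_{i}\mathbb Z_{\ge0}\alpha_i$. A *$\mathfrak g$-crystal* is a set $B$ with maps $\mathrm{wt}:B\to P$,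 $\varepsilon_i,\varphi_i:B\to\mathbb Z_{\ge0}$, $e_i,f_i:B\to B\sqcup\{0\}$ $(i\in I)$ such that: $\varphi_i(b)-\varepsilon_i(b)=\langle h_i,\mathrm{wt}(b)\rangle$ for $i\ne0$; $\langle h_0,\mathrm{wt}(b)\rangle\ge0$, and $\varphi_0(b)+\varepsilon_0(b)$ is $0$ or $1$ according as $\langle h_0,\mathrm{wt}(b)\rangle$ is zero or positive; if $e_ib\in B$ then $\varepsilon_i(e_ib)=\varepsilon_i(b)-1$, $\varphi_i(e_ib)=\varphi_i(b)+1$, $\mathrm{wt}(e_ib)=\mathrm{wt}(b)+\alpha_i$; if $f_ib\in B$ then $\varepsilon_i(f_ib)=\varepsilon_i(b)+1$, $\varphi_i(f_ib)=\varphi_i(b)-1$, $\mathrm{wt}(f_ib)=\mathrm{wt}(b)-\alpha_i$; and $f_ib=b'\iff b=e_ib'$ for $b,b'\in B$. It is a coloured graph with arrows $b\xrightarrow{i}f_ib$. The *tensor product* $B_1\otimes B_2$ is the set $B_1\times B_2$ with $\mathrm{wt}(b_1\otimes b_2)=\mathrm{wt}(b_1)+\mathrm{wt}(b_2)$ and the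 following rules ($x\otimes0=0\otimes y=0$). * For $i=\overline k$: $\varepsilon_i=\max(\varepsilon_i(b_1),\varepsilon_i(b_2)-\langle h_i,\mathrm{wt}(b_1)\rangle)$, $\varphi_i=\max(\varphi_i(b_1)+\langle h_i,\mathrm{wt}(b_2)\rangle,\varphi_i(b_2))$; $e_i$ acts on $b_1$ if $\varphi_i(b_1)\ge\varepsilon_i(b_2)$ and on $b_2$ otherwise; $f_i$ acts on $b_1$ if $\varphi_i(b_1)>\varepsilon_i(b_2)$ and on $b_2$ otherwise. * For $i=k\ge1$: $\varepsilon_i=\max(\varepsilon_i(b_1)-\langle h_i,\mathrm{wt}(b_2)\rangle,\varepsilon_i(b_2))$, $\varphi_i=\max(\varphi_i(b_1),\varphi_i(b_2)+\langle h_i,\mathrm{wt}(b_1)\rangle)$; $e_i$ acts on $b_1$ if $\varphi_i(b_2)<\varepsilon_i(b_1)$ and on $b_2$ otherwise; $f_i$ acts on $b_1$ if $\varphi_i(b_2)\le\varepsilon_i(b_1)$ and on $b_2$ otherwise. * For $i=0$: $\varepsilon_0,\varphi_0,e_0,f_0$ are those of $b_1$ if $\langle h_0,\mathrm{wt}(b_1)\rangle>0$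 and those of $b_2$ otherwise. Let $\mathscr F$ be the set of semi-infinite words $w=\cdots w_3w_2w_1$ in $\mathbf B$ with $w_{i+1}\le w_i$, with $|w_i|=1$ whenever $w_{i+1}=w_i$, and such that for some $c\in\mathbb Z$ (the *charge* of $w$) $w_i=\overline{i+c}$ for all $i\gg1$. Put $\mathrm{wt}(w)=\Lambda+\sum_b m_b\epsilon_b$, where $m_b=|\{k: w_k=b\}|-\delta_{|b|0}$. For $i\in I$ give a letter of $w$ the sign $+$ if it is the source, and $-$ if it is the target, of the arrow of colour $i$ in $$\cdots\to\overline{2}\xrightarrow{\overline 1}\overline 1\xrightarrow{0}1\xrightarrow{1}2\to\cdots,$$ and no sign otherwise, and read signs from left to right. For $i=\overline k$ (resp. $i=k\geq 1$) cancel successively pairs $(+,-)$ (resp. $(-,+)$) with no remaining sign in between, as long as possible; for $i=0$ keep only the left-most sign. Then $e_i$ changes the letter at the right-most (resp. left-most; resp. the only) remaining $-$, from the target to the source of the $i$-arrow, and $f_i$ changes the letter at the left-most (resp. right-most; resp. the only) remaining $+$ from the source to the target; the result is $0$ if there is no such sign. Put $\varepsilon_i(w)=\max\{k: e_i^kw\ne0\}$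 and $\varphi_i(w)=\max\{k: f_i^kw\neq0\}$. With these data form $\mathscr F^{\otimes u}$. Let $u\ge1$ and let $\lambda=(\lambda_1\ge\cdots\ge\lambda_u)$ be integers. Let $\mathbf B(\lambda)\subset\mathscr F^{\otimes u}$ be the set of all $\mathbf w=w^{(1)}\otimes\cdots\otimes w^{(u)}$ such that $w^{(i)}$ has charge $\lambda_i$ and, for $1\le i<u$, $k\ge1$ and $d_i=\lambda_i-\lambda_{i+1}$, one has $w^{(i)}_k\ge w^{(i+1)}_{k+d_i}$, with equality only if $|w^{(i)}_k|=0$. Let $H^\lambda=(w^{(1)},\dots,w^{(u)})$, where $w^{(i)}=\cdots\overline{\lambda_i+2}\;\overline{\lambda_i+1}$ if $\lambda_i\ge0$, and $w^{(i)}$ is $\cdots\overline 2\,\overline 1$ followed by $|\lambda_i|$ letters $u-i+1$ if $\lambda_i<0$. Then: 1. $\mathbf B(\lambda)\cup\{0\}$ is stable under $e_i$ and $f_i$ for all $i\in I$; 2. $\mathbf B(\lambda)$, with the restrictions of $\mathrm{wt},\varepsilon_i,\varphi_i,e_i,f_i$, is a $\mathfrak g$-crystal; 3. $\mathbf B(\lambda)$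 is connected as an (undirected) graph; 4. $H^\lambda$ is the unique highest weight element of $\mathbf B(\lambda)$: an element $\mathbf w\in\mathbf B(\lambda)$ satisfies $\mathrm{wt}(\mathbf w')\le\mathrm{wt}(\mathbf w)$ for all $\mathbf w'\in\mathbf B(\lambda)$ if and only if $\mathbf w=H^\lambda$. -/

import Mathlib

namespace SemiInf

/-! Encoding of letters and colours.

The ordered alphabet `⋯ < 2̄ < 1̄ < 1 < 2 < ⋯` is identified, as an ordered set, with `ℤ`:
the barred letter `k̄` is the integer `-k`, the unbarred letter `k` is the integer `k - 1` (`k ≥ 1`).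
The colours (Dynkin nodes) `⋯, 2̄, 1̄, 0, 1, 2, ⋯` are identified with `ℤ` as well: `k̄` is `-k`,
`0` is `0` and `k` is `k`. With this encoding the arrow of colour `i` in the crystal of the natural
representation goes from the letter `i - 1` to the letter `i`, for every `i : ℤ`. -/

/-- The barred letter `k̄` (`k ≥ 1`). -/
def bar (k : ℤ) : ℤ := -k

/-- The unbarred letter `k` (`k ≥ 1`). -/
def unbar (k : ℤ) : ℤ := k - 1

/-- The degree `|b|`: `0` for barred letters, `1` for unbarred letters. -/
def degree (b : ℤ) : ℕ := if b < 0 then 0 else 1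

/-! ### Weights -/

/-- The weight lattice `P = ℤ Λ ⊕ ⨁_b ℤ ε_b`: the first component is the coefficient of `Λ`. -/
abbrev Weight := ℤ × (ℤ →₀ ℤ)

/-- The symmetric form on `⨁_b ℤ ε_b` with `(ε_b, ε_b') = (-1)^|b| δ_{bb'}`. -/
def form (x y : ℤ →₀ ℤ) : ℤ := x.sum fun b a => (-1) ^ degree b * a * y b

/-- The simple root `α_i = ε_{i-1} - ε_i`. In the original notation this reads
`α_{k̄} = ε_{\overline{k+1}} - ε_{k̄}`, `α_0 = ε_{1̄} - ε_1` and `α_k = ε_k - ε_{k+1}`. -/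
noncomputable def root (i : ℤ) : ℤ →₀ ℤ :=
  Finsupp.single (i - 1) 1 - Finsupp.single i 1

/-- The pairing `⟨h_i, μ⟩` with a simple coroot: `⟨h_i, Λ⟩ = δ_{0 i}`, and on `⨁_b ℤ ε_b` it is
`(α_i, ·)` for `i = ⋯, 2̄, 1̄, 0` and `-(α_i, ·)` for `i = 1, 2, ⋯`. -/
noncomputable def coroot (i : ℤ) (μ : Weight) : ℤ :=
  (if i = 0 then μ.1 else 0) + (if i ≤ 0 then form (root i) μ.2 else -form (root i) μ.2)

/-- The simple root as an element of the weight lattice. -/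
noncomputable def simpleRoot (i : ℤ) : Weight := (0, root i)

/-- The partial order on weights: `μ ≤ ν` iff `ν - μ ∈ ∑_i ℤ_{≥0} α_i`. -/
def WeightLE (μ ν : Weight) : Prop :=
  ν - μ ∈ AddSubmonoid.closure (Set.range simpleRoot)

/-! ### Crystals -/

/-- The data of a crystal; `none` plays the role of the formal symbol `0`. -/
structure CrystalData (X : Type*) where
  wt : X → Weight
  eps : ℤ → X → ℕ
  phi : ℤ → X → ℕ
  e : ℤ → X → Option X
  f : ℤ → X → Option X

namespace CrystalData

variable {X Y : Type*}

/-- `S ∪ {0}` is stable under all the Kashiwara operators. -/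
def IsStable (C : CrystalData X) (S : Set X) : Prop :=
  ∀ i, ∀ b ∈ S, (∀ b', C.e i b = some b' → b' ∈ S) ∧ (∀ b', C.f i b = some b' → b' ∈ S)

/-- `S`, with the restrictions of `wt`, `ε_i`, `φ_i`, `e_i`, `f_i`, is a crystal. -/
structure IsCrystalOn (C : CrystalData X) (S : Set X) : Prop where
  stable : C.IsStable S
  string : ∀ i, i ≠ 0 → ∀ b ∈ S, (C.phi i b : ℤ) - C.eps i b = coroot i (C.wt b)
  odd_nonneg : ∀ b ∈ S, 0 ≤ coroot 0 (C.wt b)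
  odd_zero : ∀ b ∈ S, coroot 0 (C.wt b) = 0 → C.phi 0 b + C.eps 0 b = 0
  odd_pos : ∀ b ∈ S, 0 < coroot 0 (C.wt b) → C.phi 0 b + C.eps 0 b = 1
  e_apply : ∀ i, ∀ b ∈ S, ∀ b', C.e i b = some b' →
    (C.eps i b' : ℤ) = C.eps i b - 1 ∧ C.phi i b' = C.phi i b + 1 ∧
      C.wt b' = C.wt b + simpleRoot i
  f_apply : ∀ i, ∀ b ∈ S, ∀ b', C.f i b = some b' →
    C.eps i b' = C.eps i b + 1 ∧ (C.phi i b' : ℤ) = C.phi i b - 1 ∧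
      C.wt b' = C.wt b - simpleRoot i
  f_iff_e : ∀ i, ∀ b ∈ S, ∀ b' ∈ S, C.f i b = some b' ↔ C.e i b' = some b

/-- The coloured oriented graph on `S`, with an arrow `b → b'` of colour `i` iff `b' = f_i b`,
is connected (as an undirected graph). -/
def IsConnectedOn (C : CrystalData X) (S : Set X) : Prop :=
  S.Nonempty ∧ ∀ b b' : S, Relation.EqvGen (fun x y : S => ∃ i, C.f i x = some (y : X)) b b'

/-- `b` is a (genuine) highest weight element of `S`: its weight dominates all weights of `S`. -/
def IsHighestWeight (C : CrystalData X) (S : Set X) (b : X) : Prop :=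
  b ∈ S ∧ ∀ b' ∈ S, WeightLE (C.wt b') (C.wt b)

/-- The tensor product of crystals. In the definition of `e` and `f`, `x ⊗ 0 = 0 ⊗ y = 0`. -/
noncomputable def tensor (C : CrystalData X) (D : CrystalData Y) : CrystalData (X × Y) where
  wt b := C.wt b.1 + D.wt b.2
  eps i b :=
    if i < 0 then (max (C.eps i b.1 : ℤ) (D.eps i b.2 - coroot i (C.wt b.1))).toNat
    else if 0 < i then (max (C.eps i b.1 - coroot i (D.wt b.2)) (D.eps i b.2 : ℤ)).toNat
    else if 0 < coroot 0 (C.wt b.1) then C.eps 0 b.1 else D.eps 0 b.2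
  phi i b :=
    if i < 0 then (max (C.phi i b.1 + coroot i (D.wt b.2)) (D.phi i b.2 : ℤ)).toNat
    else if 0 < i then (max (C.phi i b.1 : ℤ) (D.phi i b.2 + coroot i (C.wt b.1))).toNat
    else if 0 < coroot 0 (C.wt b.1) then C.phi 0 b.1 else D.phi 0 b.2
  e i b :=
    let left := (C.e i b.1).map fun x => (x, b.2)
    let right := (D.e i b.2).map fun y => (b.1, y)
    if i < 0 then (if D.eps i b.2 ≤ C.phi i b.1 then left else right)
    else if 0 < i then (if D.phi i b.2 < C.eps i b.1 then left else right)
    else if 0 < coroot 0 (C.wt b.1) then left else right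
  f i b :=
    let left := (C.f i b.1).map fun x => (x, b.2)
    let right := (D.f i b.2).map fun y => (b.1, y)
    if i < 0 then (if D.eps i b.2 < C.phi i b.1 then left else right)
    else if 0 < i then (if D.phi i b.2 ≤ C.eps i b.1 then left else right)
    else if 0 < coroot 0 (C.wt b.1) then left else right

/-- The trivial crystal structure (used on a one-point set; it is the unit for `⊗`). -/
def unit (X : Type*) : CrystalData X where
  wt _ := 0
  eps _ _ := 0
  phi _ _ := 0
  e _ _ := none
  f _ _ := none

/-- Transport of crystal data along a bijection. -/
def transport (C : CrystalData X) (g : X ≃ Y) : CrystalData Y where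
  wt y := C.wt (g.symm y)
  eps i y := C.eps i (g.symm y)
  phi i y := C.phi i (g.symm y)
  e i y := (C.e i (g.symm y)).map g
  f i y := (C.f i (g.symm y)).map g

/-- The tensor power `C ⊗ (C ⊗ (⋯ ⊗ C))` on `u`-tuples; the tuple `w` is `w 0 ⊗ w 1 ⊗ ⋯`. -/
noncomputable def tensorPow (C : CrystalData X) : (u : ℕ) → CrystalData (Fin u → X)
  | 0 => unit _
  | u + 1 => (tensor C (tensorPow C u)).transport (Fin.consEquiv fun _ : Fin (u + 1) => X)

end CrystalData

/-! ### Semi-infinite words -/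

/-- The word `⋯ w_3 w_2 w_1` has charge `c`: `w_i = \overline{i + c}` for all large `i`.
Words are indexed from `0`, so that `w_i` is `w (i - 1)`. -/
def HasCharge (w : ℕ → ℤ) (c : ℤ) : Prop :=
  ∀ᶠ k : ℕ in Filter.atTop, w k = bar ((k : ℤ) + 1 + c)

/-- Semi-infinite words `⋯ w_3 w_2 w_1`, where `w_i` is `letter (i - 1)`. -/
@[ext]
structure Word where
  letter : ℕ → ℤ
  mono : ∀ k, letter (k + 1) ≤ letter k
  degree_of_eq : ∀ k, letter (k + 1) = letter k → degree (letter k) = 1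
  charge : ∃ c, HasCharge letter c

/-- The three signs `+`, `-` and `·`. -/
inductive Sgn
  | plus
  | minus
  | dot

/-- The sign of a letter with respect to the colour `i`: the source of the `i`-arrow has sign `+`,
its target has sign `-`. -/
def sgn (i : ℤ) (b : ℤ) : Sgn :=
  if b = i - 1 then Sgn.plus else if b = i then Sgn.minus else Sgn.dot

/-- One cancellation: a pair `(a, b)`, `a` on the left of `b`, with only `·` in between, is replaced
by `(·, ·)`. Positions of a sequence `⋯ σ 2, σ 1, σ 0` with larger index are further to the left. -/
def CancelStep (a b : Sgn) (σ τ : ℕ → Sgn) : Prop :=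
  ∃ s s', s' < s ∧ σ s = a ∧ σ s' = b ∧ (∀ t, s' < t → t < s → σ t = Sgn.dot) ∧
    τ = Function.update (Function.update σ s Sgn.dot) s' Sgn.dot

/-- `τ` arises from `σ` by cancelling `(a, b)`-pairs until no `a` is on the left of a `b`. -/
def FullyCancelled (a b : Sgn) (σ τ : ℕ → Sgn) : Prop :=
  Relation.ReflTransGen (CancelStep a b) σ τ ∧ ∀ s s', s' < s → ¬(τ s = a ∧ τ s' = b)

open Classical in
/-- `τ` is the `i`-signature of a word with sign sequence `σ`: cancel `(+, -)` if `i < 0` (that is,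
`i` is barred), cancel `(-, +)` if `i > 0`, and keep only the left-most sign if `i = 0`. -/
def IsSignature (i : ℤ) (σ τ : ℕ → Sgn) : Prop :=
  (i < 0 → FullyCancelled Sgn.plus Sgn.minus σ τ) ∧
  (0 < i → FullyCancelled Sgn.minus Sgn.plus σ τ) ∧
  (i = 0 → ∀ k, τ k = if ∀ l, k < l → σ l = Sgn.dot then σ k else Sgn.dot)

/-- Position `k` carries the `i`-good `-` sign: the right-most (`i < 0`) resp. left-most (`i > 0`)
`-` of the `i`-signature, or the `0`-signature is a `-` at `k`. -/
def IsGoodMinus (i : ℤ) (w : ℕ → ℤ) (k : ℕ) : Prop :=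
  ∃ τ, IsSignature i (fun j => sgn i (w j)) τ ∧ τ k = Sgn.minus ∧
    (i < 0 → ∀ l, l < k → τ l ≠ Sgn.minus) ∧ (0 < i → ∀ l, k < l → τ l ≠ Sgn.minus)

/-- Position `k` carries the `i`-good `+` sign: the left-most (`i < 0`) resp. right-most (`i > 0`)
`+` of the `i`-signature, or the `0`-signature is a `+` at `k`. -/
def IsGoodPlus (i : ℤ) (w : ℕ → ℤ) (k : ℕ) : Prop :=
  ∃ τ, IsSignature i (fun j => sgn i (w j)) τ ∧ τ k = Sgn.plus ∧
    (i < 0 → ∀ l, k < l → τ l ≠ Sgn.plus) ∧ (0 < i → ∀ l, l < k → τ l ≠ Sgn.plus)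

theorem sgn_eq_plus {i b : ℤ} : sgn i b = Sgn.plus ↔ b = i - 1 := by
  unfold sgn; split_ifs <;> simp_all

theorem sgn_eq_minus {i b : ℤ} : sgn i b = Sgn.minus ↔ b = i := by
  unfold sgn; split_ifs <;> simp_all

theorem sgn_eq_dot {i b : ℤ} : sgn i b = Sgn.dot ↔ b ≠ i - 1 ∧ b ≠ i := by
  unfold sgn; split_ifs <;> simp_all

theorem CancelStep.apply_eq {a b : Sgn} {σ τ : ℕ → Sgn} (h : CancelStep a b σ τ) (k : ℕ) :
    τ k = σ k ∨ τ k = Sgn.dot := by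
  obtain ⟨s, s', -, -, -, -, rfl⟩ := h
  by_cases h1 : k = s' <;> by_cases h2 : k = s <;> simp [Function.update_apply, h1, h2]

theorem FullyCancelled.apply_eq {a b : Sgn} {σ τ : ℕ → Sgn} (h : FullyCancelled a b σ τ) (k : ℕ) :
    τ k = σ k ∨ τ k = Sgn.dot := by
  obtain ⟨h, -⟩ := h
  induction h with
  | refl => exact Or.inl rfl
  | tail _ hs ih =>
    rcases hs.apply_eq k with h' | h'
    · rw [h']; exact ih
    · exact Or.inr h'

theorem IsSignature.apply_eq {i : ℤ} {σ τ : ℕ → Sgn} (h : IsSignature i σ τ) (k : ℕ) :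
    τ k = σ k ∨ τ k = Sgn.dot := by
  rcases lt_trichotomy i 0 with hi | hi | hi
  · exact (h.1 hi).apply_eq k
  · rw [h.2.2 hi k]; split_ifs <;> simp
  · exact (h.2.1 hi).apply_eq k

/-- Adjacent `(a, b)` are cancelled. -/
theorem FullyCancelled.adjacent {a b : Sgn} {σ τ : ℕ → Sgn} (h : FullyCancelled a b σ τ)
    (hab : a ≠ b) (ha : a ≠ Sgn.dot) (hb : b ≠ Sgn.dot) {k : ℕ} (h1 : σ (k + 1) = a)
    (h2 : σ k = b) : τ (k + 1) = Sgn.dot ∧ τ k = Sgn.dot := by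
  obtain ⟨h, hr⟩ := h
  have key : (τ (k + 1) = a ∧ τ k = b) ∨ (τ (k + 1) = Sgn.dot ∧ τ k = Sgn.dot) := by
    clear hr
    induction h with
    | refl => exact Or.inl ⟨h1, h2⟩
    | @tail ρ τ _ hs ih =>
      rcases ih with ⟨e1, e2⟩ | ⟨e1, e2⟩
      · obtain ⟨s, s', hlt, q1, q2, q3, rfl⟩ := hs
        have n1 : s' ≠ k + 1 := by rintro rfl; exact hab (e1.symm.trans q2)
        have n2 : s ≠ k := by rintro rfl; exact hab (q1.symm.trans e2)
        by_cases c1 : s = k + 1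
        · have c2 : s' = k := by
            by_contra hne
            exact hb (e2.symm.trans (q3 k (by omega) (by omega)))
          subst c1; subst c2
          right; simp
        · have c2 : s' ≠ k := by
            intro hk
            exact ha (e1.symm.trans (q3 (k + 1) (by omega) (by omega)))
          left
          simp [Ne.symm n1, Ne.symm n2, Ne.symm c1, Ne.symm c2, e1, e2]
      · right
        constructor
        · rcases hs.apply_eq (k + 1) with h' | h'
          · rw [h', e1]
          · exact h'
        · rcases hs.apply_eq k with h' | h'
          · rw [h', e2]
          · exact h'
  rcases key with ⟨e1, e2⟩ | h
  · exact absurd ⟨e1, e2⟩ (hr (k + 1) k (Nat.lt_succ_self k))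
  · exact h

theorem FullyCancelled.eq_self {a b : Sgn} {σ τ : ℕ → Sgn} (h : FullyCancelled a b σ τ)
    (hno : ∀ s s', s' < s → ¬(σ s = a ∧ σ s' = b)) : τ = σ := by
  rcases Relation.ReflTransGen.cases_head h.1 with h' | ⟨ρ, ⟨s, s', hlt, q1, q2, -⟩, -⟩
  · exact h'.symm
  · exact absurd ⟨q1, q2⟩ (hno s s' hlt)

theorem degree_eq_one {b : ℤ} : degree b = 1 ↔ 0 ≤ b := by
  unfold degree; split_ifs with h <;> simp <;> omega

namespace Word

theorem antitone (w : Word) : Antitone w.letter := antitone_nat_of_succ_le w.mono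

/-- Replace the letter at position `k`. -/
def replace (w : Word) (k : ℕ) (b : ℤ) (h1 : w.letter (k + 1) ≤ b)
    (h1' : w.letter (k + 1) = b → 0 ≤ b) (h2 : ∀ j, j + 1 = k → b ≤ w.letter j)
    (h2' : ∀ j, j + 1 = k → b = w.letter j → 0 ≤ b) : Word where
  letter := Function.update w.letter k b
  mono j := by
    have := w.mono j
    by_cases c1 : j = k
    · subst c1; simpa [Function.update_apply] using h1
    · by_cases c2 : j + 1 = k
      · simpa [Function.update_apply, c1, c2] using h2 j c2
      · simpa [Function.update_apply, c1, c2] using this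
  degree_of_eq j := by
    have := w.degree_of_eq j
    rw [degree_eq_one] at this ⊢
    by_cases c1 : j = k
    · subst c1; simpa [Function.update_apply] using h1'
    · by_cases c2 : j + 1 = k
      · have h := h2' j c2
        simp only [Function.update_apply, c1, c2, if_true, if_false]
        intro h3; rw [← h3]; exact h h3
      · simpa [Function.update_apply, c1, c2] using this
  charge := by
    obtain ⟨c, hc⟩ := w.charge
    refine ⟨c, ?_⟩
    filter_upwards [hc, Filter.eventually_gt_atTop k] with j hj hjk
    rw [Function.update_of_ne hjk.ne']; exact hj

theorem goodMinus_letter {w : Word} {i : ℤ} {k : ℕ} (h : IsGoodMinus i w.letter k) :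
    w.letter k = i := by
  obtain ⟨τ, hs, hk, -⟩ := h
  rcases hs.apply_eq k with h' | h'
  · rw [hk] at h'; exact sgn_eq_minus.1 h'.symm
  · rw [hk] at h'; simp at h'

theorem goodPlus_letter {w : Word} {i : ℤ} {k : ℕ} (h : IsGoodPlus i w.letter k) :
    w.letter k = i - 1 := by
  obtain ⟨τ, hs, hk, -⟩ := h
  rcases hs.apply_eq k with h' | h'
  · rw [hk] at h'; exact sgn_eq_plus.1 h'.symm
  · rw [hk] at h'; simp at h'

theorem no_minus_plus (w : Word) (i : ℤ) (s s' : ℕ) (h : s' < s) :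
    ¬(sgn i (w.letter s) = Sgn.minus ∧ sgn i (w.letter s') = Sgn.plus) := by
  rw [sgn_eq_minus, sgn_eq_plus]
  have := w.antitone h.le
  omega

theorem goodMinus_next {w : Word} {i : ℤ} {k : ℕ} (h : IsGoodMinus i w.letter k) :
    w.letter (k + 1) ≤ i - 1 ∧ (w.letter (k + 1) = i - 1 → 0 ≤ i - 1) := by
  have hk := goodMinus_letter h
  obtain ⟨τ, hs, hm, hneg, hpos⟩ := h
  have hmono := w.mono k
  have hdeg := w.degree_of_eq k
  rw [degree_eq_one] at hdeg
  rcases lt_trichotomy i 0 with hi | hi | hi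
  · have hne : w.letter (k + 1) ≠ i - 1 := by
      intro h1
      have := ((hs.1 hi).adjacent (by simp) (by simp) (by simp)
        (sgn_eq_plus.2 h1) (sgn_eq_minus.2 hk)).2
      rw [hm] at this; simp at this
    omega
  · subst hi
    have hd : w.letter (k + 1) ≠ -1 ∧ w.letter (k + 1) ≠ 0 := by
      have h0 := hs.2.2 rfl k
      rw [hm] at h0
      split_ifs at h0 with hall
      simpa using sgn_eq_dot.1 (hall (k + 1) (Nat.lt_succ_self k))
    omega
  · have hτ := (hs.2.1 hi).eq_self (w.no_minus_plus i)
    subst hτ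
    have := hpos hi (k + 1) (Nat.lt_succ_self k)
    rw [Ne, sgn_eq_minus] at this
    omega

theorem goodPlus_prev {w : Word} {i : ℤ} {j : ℕ} (h : IsGoodPlus i w.letter (j + 1)) :
    i ≤ w.letter j ∧ (i = w.letter j → 0 ≤ i) := by
  have hk := goodPlus_letter h
  obtain ⟨τ, hs, hm, hneg, hpos⟩ := h
  have hmono := w.mono j
  have hdeg := w.degree_of_eq j
  rw [degree_eq_one] at hdeg
  rcases lt_trichotomy i 0 with hi | hi | hi
  · have hne : w.letter j ≠ i := by
      intro h1
      have := ((hs.1 hi).adjacent (by simp) (by simp) (by simp)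
        (sgn_eq_plus.2 hk) (sgn_eq_minus.2 h1)).1
      rw [hm] at this; simp at this
    omega
  · omega
  · have hτ := (hs.2.1 hi).eq_self (w.no_minus_plus i)
    subst hτ
    have := hpos hi j (Nat.lt_succ_self j)
    rw [Ne, sgn_eq_plus] at this
    omega

/-- Apply `e_i` to the letter at the position of the `i`-good `-` sign. -/
def applyE (w : Word) (i : ℤ) (k : ℕ) (h : IsGoodMinus i w.letter k) : Word :=
  w.replace k (i - 1) (goodMinus_next h).1 (goodMinus_next h).2
    (fun j hj => by
      subst hj; have := goodMinus_letter h; have := w.mono j; omega)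
    (fun j hj h' => by
      subst hj; have := goodMinus_letter h; have := w.mono j; omega)

/-- Apply `f_i` to the letter at the position of the `i`-good `+` sign. -/
def applyF (w : Word) (i : ℤ) (k : ℕ) (h : IsGoodPlus i w.letter k) : Word :=
  w.replace k i
    (by have := goodPlus_letter h; have := w.mono k; omega)
    (by have := goodPlus_letter h; have := w.mono k; omega)
    (fun j hj => by subst hj; exact (goodPlus_prev h).1)
    (fun j hj => by subst hj; exact (goodPlus_prev h).2)

open Classical in
/-- The Kashiwara operator `e_i` on semi-infinite words. -/
noncomputable def eOp (i : ℤ) (w : Word) : Option Word :=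
  if h : ∃ k, IsGoodMinus i w.letter k then some (w.applyE i h.choose h.choose_spec) else none

open Classical in
/-- The Kashiwara operator `f_i` on semi-infinite words. -/
noncomputable def fOp (i : ℤ) (w : Word) : Option Word :=
  if h : ∃ k, IsGoodPlus i w.letter k then some (w.applyF i h.choose h.choose_spec) else none

/-- `m_b`, the number of occurrences of `b` in `w`, minus `1` if `|b| = 0`. -/
noncomputable def mult (w : Word) (b : ℤ) : ℤ :=
  ({k : ℕ | w.letter k = b}.ncard : ℤ) - if degree b = 0 then 1 else 0

theorem mult_support_finite (w : Word) : (Function.support w.mult).Finite := by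
  obtain ⟨c, hc⟩ := w.charge
  obtain ⟨K, hK⟩ := Filter.eventually_atTop.1 hc
  refine (Set.finite_Icc (min 0 (-((K : ℤ) + 1 + c))) (max 0 (w.letter 0))).subset ?_
  intro b hb
  by_contra hout
  apply hb
  rw [Set.mem_Icc, not_and_or, not_le, not_le] at hout
  rcases hout with h | h
  · rw [lt_min_iff] at h
    have hset : {k : ℕ | w.letter k = b} = {(-b - 1 - c).toNat} := by
      ext k
      simp only [Set.mem_ofPred_eq, Set.mem_singleton_iff]
      constructor
      · intro hk
        have hKk : K ≤ k := by
          by_contra hlt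
          have h1 := w.antitone (not_le.1 hlt).le
          have h2 := hK K le_rfl
          simp only [bar] at h2
          omega
        have h2 := hK k hKk
        simp only [bar] at h2
        omega
      · rintro rfl
        have h2 := hK (-b - 1 - c).toNat (by omega)
        simp only [bar] at h2
        rw [h2]
        omega
    simp [mult, hset, degree, h.1]
  · rw [max_lt_iff] at h
    have hset : {k : ℕ | w.letter k = b} = ∅ := by
      ext k
      simp only [Set.mem_ofPred_eq, Set.mem_empty_iff_false, iff_false]
      intro hk
      have h1 := w.antitone (Nat.zero_le k)
      omega
    have hb' : ¬ b < 0 := by omega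
    simp [mult, hset, degree, hb']

/-- The weight `Λ + ∑_b m_b ε_b` of a semi-infinite word. -/
noncomputable def wt (w : Word) : Weight := (1, Finsupp.ofSupportFinite w.mult w.mult_support_finite)

/-- `max {k | g^k x ≠ 0}` for a partially defined operator `g`. -/
noncomputable def maxIter {X : Type*} (g : X → Option X) (x : X) : ℕ :=
  sSup {k : ℕ | (fun y : Option X => y.bind g)^[k] (some x) ≠ none}

/-- The crystal `𝓕` of semi-infinite words. -/
noncomputable def crystal : CrystalData Word where
  wt := wt
  eps i := maxIter (eOp i)
  phi i := maxIter (fOp i)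
  e := eOp
  f := fOp

end Word

/-! ### Semi-infinite semistandard tableaux -/

/-- `𝐁(λ)`: the semistandard tableaux of charge `λ`. The column `w^{(i)}` is `w (i - 1)`. -/
def tableaux {u : ℕ} (lam : Fin u → ℤ) : Set (Fin u → Word) :=
  {w | (∀ i, HasCharge (w i).letter (lam i)) ∧
    ∀ i j : Fin u, (j : ℕ) = i + 1 → ∀ k : ℕ,
      (w j).letter (k + (lam i - lam j).toNat) ≤ (w i).letter k ∧
      ((w i).letter k = (w j).letter (k + (lam i - lam j).toNat) → degree ((w i).letter k) = 0)}

/-- The word `⋯ \overline{c+2} \overline{c+1}` if `c ≥ 0`, and the word `⋯ 2̄ 1̄ j ⋯ j`, with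
`|c|` letters `j`, if `c < 0`; here `j ≥ 1`. -/
def hwWord (c : ℤ) (j : ℕ) (hj : 1 ≤ j) : Word where
  letter k := if (k : ℤ) + c < 0 then unbar j else bar ((k : ℤ) + 1 + c)
  mono k := by
    simp only [unbar, bar]; push_cast; split_ifs <;> omega
  degree_of_eq k := by
    simp only [unbar, bar, degree]; push_cast; split_ifs <;> omega
  charge := by
    refine ⟨c, ?_⟩
    filter_upwards [Filter.eventually_ge_atTop (-c).toNat] with k hk
    rw [if_neg (by omega)]

/-- `H^λ`: its `i`-th column (`i = 1, ⋯, u`) is `⋯ \overline{λ_i+2} \overline{λ_i+1}` if `λ_i ≥ 0`,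
and `⋯ 2̄ 1̄` followed by `|λ_i|` letters `u - i + 1` if `λ_i < 0`. -/
def highest {u : ℕ} (lam : Fin u → ℤ) : Fin u → Word :=
  fun i => hwWord (lam i) (u - i) (by omega)

end SemiInf

/-! On `ℱ^{⊗u}` the functions `ε_i`, `φ_i` are the lengths of the `i`-strings, so the tensor product
rules become statements about these numbers alone. By (one half of) associativity an operator acting
on a tensor product acts on any two adjacent factors as on their tensor product, or not at all;
hence stability of the tableaux needs to be checked for two columns only.

For connectedness, place position `k` of a word of charge `c` in row `k + c`, so that the vacuum has
`\overline{r + 1}` in row `r`. Given a tableau which is the vacuum in the rows `r ≥ K`, let `M` be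
the number of its boxes in the rows `r < K`, and apply the `f_i` with `-K < i ≤ M` until all these
`φ_i` vanish. If a barred letter `b` were left in a row `r < K`, then the vanishing of `φ_i` for
`b < i ≤ M` would force all the letters `b, …, M` to occur, among them `M + 1` unbarred ones, which
are too many for `M` boxes. The resulting tableau, with unbarred letters in the rows `r < K`, is
then moved by the `e_i` with `i > 0` to the least such tableau, which depends only on `K` and `λ`.
The highest weight element is the least tableau for `K = 0`: it is letterwise minimal, hence of
maximal weight. -/

namespace SemiInf

theorem form_root (i : ℤ) (y : ℤ →₀ ℤ) :
    form (root i) y = (-1) ^ degree (i - 1) * y (i - 1) - (-1) ^ degree i * y i := by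
  unfold form root
  rw [Finsupp.sum_sub_index (by intros; ring), Finsupp.sum_single_index (by ring),
    Finsupp.sum_single_index (by ring)]
  ring

theorem coroot_of_ne {i : ℤ} (hi : i ≠ 0) (μ : Weight) : coroot i μ = μ.2 (i - 1) - μ.2 i := by
  rcases hi.lt_or_gt with hi | hi
  · simp [coroot, form_root, hi.ne, hi.le, degree, hi, show i - 1 < 0 by omega]
  · simp [coroot, form_root, hi.ne', hi.not_ge, degree, hi.not_gt, show ¬ i - 1 < 0 by omega]
    ring

theorem coroot_zero (μ : Weight) : coroot 0 μ = μ.1 + μ.2 (-1) + μ.2 0 := by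
  simp [coroot, form_root, degree]
  ring

theorem coroot_add (i : ℤ) (μ ν : Weight) : coroot i (μ + ν) = coroot i μ + coroot i ν := by
  rcases eq_or_ne i 0 with rfl | hi
  · simp only [coroot_zero, Prod.fst_add, Prod.snd_add, Finsupp.add_apply]; ring
  · simp only [coroot_of_ne hi, Prod.snd_add, Finsupp.add_apply]; ring

theorem coroot_weight_zero (i : ℤ) : coroot i 0 = 0 :=
  map_zero (AddMonoidHom.mk' (coroot i) (coroot_add i))

theorem coroot_sum {ι : Type*} (i : ℤ) (s : Finset ι) (μ : ι → Weight) :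
    coroot i (∑ j ∈ s, μ j) = ∑ j ∈ s, coroot i (μ j) :=
  map_sum (AddMonoidHom.mk' (coroot i) (coroot_add i)) μ s

theorem root_apply (i b : ℤ) :
    root i b = (if b = i - 1 then 1 else 0) - (if b = i then 1 else 0) := by
  simp [root, Finsupp.single_apply, eq_comm]

/-- The height of a weight: the additive function with value `-b` at `ε_b` and `0` at `Λ`,
normalized so that every simple root has height `1`. -/
noncomputable def height : Weight →+ ℤ :=
  (Finsupp.liftAddHom fun b => AddMonoidHom.mulLeft (-b)).comp (AddMonoidHom.snd ℤ (ℤ →₀ ℤ))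

theorem height_single_sub_single (a b : ℤ) :
    height (0, Finsupp.single a 1 - Finsupp.single b 1) = b - a := by
  simp only [height, AddMonoidHom.comp_apply, AddMonoidHom.coe_snd, map_sub,
    Finsupp.liftAddHom_apply_single, AddMonoidHom.coe_mulLeft]
  ring

theorem height_simpleRoot (i : ℤ) : height (simpleRoot i) = 1 := by
  rw [simpleRoot, root, height_single_sub_single, sub_sub_cancel]

theorem WeightLE.height_le {μ ν : Weight} (h : WeightLE μ ν) : height μ ≤ height ν := by
  rw [← sub_nonneg, ← map_sub]
  have hle : AddSubmonoid.closure (Set.range simpleRoot) ≤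
      (AddSubmonoid.nonneg ℤ).comap height := by
    rw [AddSubmonoid.closure_le]
    rintro _ ⟨i, rfl⟩
    exact zero_le_one.trans_eq (height_simpleRoot i).symm
  exact hle h

theorem single_sub_single_mem_closure {a b : ℤ} (h : a ≤ b) :
    ((0, Finsupp.single a 1 - Finsupp.single b 1) : Weight) ∈
      AddSubmonoid.closure (Set.range simpleRoot) := by
  induction b, h using Int.leInduction with
  | base =>
    rw [sub_self]
    exact AddSubmonoid.zero_mem _
  | succ b _ ih =>
    have hsplit : ((0, Finsupp.single a 1 - Finsupp.single (b + 1) 1) : Weight) =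
        (0, Finsupp.single a 1 - Finsupp.single b 1) + simpleRoot (b + 1) := by
      simp only [simpleRoot, root, add_sub_cancel_right, Prod.mk_add_mk, add_zero,
        sub_add_sub_cancel]
    rw [hsplit]
    exact AddSubmonoid.add_mem _ ih (AddSubmonoid.subset_closure ⟨_, rfl⟩)

namespace CrystalData

variable {X Y Z : Type*}

/-- A seminormal crystal: all axioms of a crystal hold on the whole of `X`, and `ε_i`, `φ_i` are the
lengths of the `i`-strings, that is, `e_i b ≠ 0` whenever `ε_i b > 0`, and `f_i b ≠ 0` whenever
`φ_i b > 0`. The axioms on `⟨h_0, wt b⟩` are combined into one equation, and those on `f_i` are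
left out since they follow from those on `e_i` by `f_iff_e`. -/
structure IsSeminormal (C : CrystalData X) : Prop where
  string : ∀ i ≠ 0, ∀ b, (C.phi i b : ℤ) - C.eps i b = coroot i (C.wt b)
  odd : ∀ b, (C.phi 0 b : ℤ) + C.eps 0 b = min 1 (coroot 0 (C.wt b))
  f_iff_e : ∀ i b b', C.f i b = some b' ↔ C.e i b' = some b
  eps_of_e : ∀ i b b', C.e i b = some b' → C.eps i b = C.eps i b' + 1
  phi_of_e : ∀ i b b', C.e i b = some b' → C.phi i b' = C.phi i b + 1
  wt_of_e : ∀ i b b', C.e i b = some b' → C.wt b' = C.wt b + simpleRoot i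
  exists_e : ∀ i b, 0 < C.eps i b → ∃ b', C.e i b = some b'
  exists_f : ∀ i b, 0 < C.phi i b → ∃ b', C.f i b = some b'

theorem IsSeminormal.isCrystalOn {C : CrystalData X} (hC : C.IsSeminormal) {S : Set X}
    (hS : C.IsStable S) : C.IsCrystalOn S where
  stable := hS
  string i hi b _ := hC.string i hi b
  odd_nonneg b _ := by have := hC.odd b; omega
  odd_zero b _ h := by have := hC.odd b; omega
  odd_pos b _ h := by have := hC.odd b; omega
  e_apply i b _ b' h := by
    have := hC.eps_of_e i b b' h
    exact ⟨by omega, hC.phi_of_e i b b' h, hC.wt_of_e i b b' h⟩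
  f_apply i b _ b' h := by
    rw [hC.f_iff_e] at h
    have := hC.phi_of_e i b' b h
    exact ⟨hC.eps_of_e i b' b h, by omega, eq_sub_of_add_eq (hC.wt_of_e i b' b h).symm⟩
  f_iff_e i b _ b' _ := hC.f_iff_e i b b'

section Tensor

variable {C : CrystalData X} {D : CrystalData Y} {E : CrystalData Z} {i : ℤ} {x x' : X} {y y' : Y}

/-- The condition for `e_i` to act on the left factor of `x ⊗ y`. For `i = 0` the condition
`⟨h_0, wt x⟩ > 0` is expressed through `ε_0 x` and `φ_0 x`. -/
def ELeft (C : CrystalData X) (D : CrystalData Y) (i : ℤ) (x : X) (y : Y) : Prop :=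
  (i < 0 → D.eps i y ≤ C.phi i x) ∧ (0 < i → D.phi i y < C.eps i x) ∧
    (i = 0 → 0 < C.eps i x + C.phi i x)

/-- The condition for `f_i` to act on the left factor of `x ⊗ y`; compare `ELeft`. -/
def FLeft (C : CrystalData X) (D : CrystalData Y) (i : ℤ) (x : X) (y : Y) : Prop :=
  (i < 0 → D.eps i y < C.phi i x) ∧ (0 < i → D.phi i y ≤ C.eps i x) ∧
    (i = 0 → 0 < C.eps i x + C.phi i x)

theorem IsSeminormal.coroot_zero_pos_iff (hC : C.IsSeminormal) :
    0 < coroot 0 (C.wt x) ↔ 0 < C.eps 0 x + C.phi 0 x := by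
  have := hC.odd x
  omega

theorem tensor_e_eq_some (hC : C.IsSeminormal) :
    (tensor C D).e i (x, y) = some (x', y') ↔
      (ELeft C D i x y ∧ C.e i x = some x' ∧ y' = y) ∨
        (¬ ELeft C D i x y ∧ D.e i y = some y' ∧ x' = x) := by
  classical
  have hleft : (tensor C D).e i (x, y) =
      if ELeft C D i x y then (C.e i x).map (·, y) else (D.e i y).map (x, ·) := by
    simp only [tensor, ELeft, hC.coroot_zero_pos_iff]
    grind
  rw [hleft]
  split_ifs with h <;> simp [h, eq_comm]

theorem tensor_f_eq_some (hC : C.IsSeminormal) :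
    (tensor C D).f i (x, y) = some (x', y') ↔
      (FLeft C D i x y ∧ C.f i x = some x' ∧ y' = y) ∨
        (¬ FLeft C D i x y ∧ D.f i y = some y' ∧ x' = x) := by
  classical
  have hleft : (tensor C D).f i (x, y) =
      if FLeft C D i x y then (C.f i x).map (·, y) else (D.f i y).map (x, ·) := by
    simp only [tensor, FLeft, hC.coroot_zero_pos_iff]
    grind
  rw [hleft]
  split_ifs with h <;> simp [h, eq_comm]

theorem tensor_eps (hC : C.IsSeminormal) (hD : D.IsSeminormal) (i : ℤ) (x : X) (y : Y) :
    (tensor C D).eps i (x, y) =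
      if i < 0 then C.eps i x + (D.eps i y - C.phi i x)
      else if 0 < i then D.eps i y + (C.eps i x - D.phi i y)
      else if 0 < C.eps 0 x + C.phi 0 x then C.eps 0 x else D.eps 0 y := by
  have hx := hC.string i
  have hy := hD.string i
  simp only [tensor, hC.coroot_zero_pos_iff]
  split_ifs with hneg hpos
  · have := hx hneg.ne x
    omega
  · have := hy hpos.ne' y
    omega
  all_goals rfl

theorem tensor_phi (hC : C.IsSeminormal) (hD : D.IsSeminormal) (i : ℤ) (x : X) (y : Y) :
    (tensor C D).phi i (x, y) =
      if i < 0 then D.phi i y + (C.phi i x - D.eps i y)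
      else if 0 < i then C.phi i x + (D.phi i y - C.eps i x)
      else if 0 < C.eps 0 x + C.phi 0 x then C.phi 0 x else D.phi 0 y := by
  have hx := hC.string i
  have hy := hD.string i
  simp only [tensor, hC.coroot_zero_pos_iff]
  split_ifs with hneg hpos
  · have := hy hneg.ne y
    omega
  · have := hx hpos.ne' x
    omega
  all_goals rfl

theorem tensor_wt (C : CrystalData X) (D : CrystalData Y) (x : X) (y : Y) :
    (tensor C D).wt (x, y) = C.wt x + D.wt y := rfl

theorem fLeft_iff_eLeft_of_e_left (hC : C.IsSeminormal) (he : C.e i x' = some x) :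
    FLeft C D i x y ↔ ELeft C D i x' y := by
  have heps := hC.eps_of_e i x' x he
  have hphi := hC.phi_of_e i x' x he
  unfold FLeft ELeft
  omega

theorem fLeft_iff_eLeft_of_e_right (hD : D.IsSeminormal) (he : D.e i y' = some y) :
    FLeft C D i x y ↔ ELeft C D i x y' := by
  have heps := hD.eps_of_e i y' y he
  have hphi := hD.phi_of_e i y' y he
  unfold FLeft ELeft
  omega

theorem tensor_f_iff_e (hC : C.IsSeminormal) (hD : D.IsSeminormal) (b b' : X × Y) :
    (tensor C D).f i b = some b' ↔ (tensor C D).e i b' = some b := by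
  obtain ⟨x, y⟩ := b
  obtain ⟨x', y'⟩ := b'
  rw [tensor_f_eq_some hC, tensor_e_eq_some hC, hC.f_iff_e, hD.f_iff_e]
  refine or_congr ?_ ?_
  · constructor <;> rintro ⟨hl, he, rfl⟩
    · exact ⟨(fLeft_iff_eLeft_of_e_left hC he).1 hl, he, rfl⟩
    · exact ⟨(fLeft_iff_eLeft_of_e_left hC he).2 hl, he, rfl⟩
  · constructor <;> rintro ⟨hr, he, rfl⟩
    · exact ⟨(fLeft_iff_eLeft_of_e_right hD he).not.1 hr, he, rfl⟩
    · exact ⟨(fLeft_iff_eLeft_of_e_right hD he).not.2 hr, he, rfl⟩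

theorem tensor_string_of_e (hC : C.IsSeminormal) (hD : D.IsSeminormal) (b b' : X × Y)
    (h : (tensor C D).e i b = some b') :
    (tensor C D).eps i b = (tensor C D).eps i b' + 1 ∧
      (tensor C D).phi i b' = (tensor C D).phi i b + 1 := by
  obtain ⟨x, y⟩ := b
  obtain ⟨x', y'⟩ := b'
  simp only [tensor_eps hC hD, tensor_phi hC hD]
  rw [tensor_e_eq_some hC] at h
  unfold ELeft at h
  rcases h with ⟨hl, he, rfl⟩ | ⟨hr, he, rfl⟩
  · have heps := hC.eps_of_e i x x' he
    have hphi := hC.phi_of_e i x x' he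
    grind
  · have heps := hD.eps_of_e i y y' he
    have hphi := hD.phi_of_e i y y' he
    grind

theorem tensor_wt_of_e (hC : C.IsSeminormal) (hD : D.IsSeminormal) (b b' : X × Y)
    (h : (tensor C D).e i b = some b') : (tensor C D).wt b' = (tensor C D).wt b + simpleRoot i := by
  obtain ⟨x, y⟩ := b
  obtain ⟨x', y'⟩ := b'
  rw [tensor_wt, tensor_wt]
  rcases (tensor_e_eq_some hC).1 h with ⟨-, he, rfl⟩ | ⟨-, he, rfl⟩
  · rw [hC.wt_of_e i x x' he, add_right_comm]
  · rw [hD.wt_of_e i y y' he, add_assoc]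

theorem tensor_exists_e (hC : C.IsSeminormal) (hD : D.IsSeminormal) (b : X × Y)
    (h : 0 < (tensor C D).eps i b) : ∃ b', (tensor C D).e i b = some b' := by
  obtain ⟨x, y⟩ := b
  rw [tensor_eps hC hD] at h
  by_cases hl : ELeft C D i x y
  · obtain ⟨x', hx'⟩ := hC.exists_e i x (by unfold ELeft at hl; grind)
    exact ⟨(x', y), (tensor_e_eq_some hC).2 (Or.inl ⟨hl, hx', rfl⟩)⟩
  · obtain ⟨y', hy'⟩ := hD.exists_e i y (by unfold ELeft at hl; grind)
    exact ⟨(x, y'), (tensor_e_eq_some hC).2 (Or.inr ⟨hl, hy', rfl⟩)⟩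

theorem tensor_exists_f (hC : C.IsSeminormal) (hD : D.IsSeminormal) (b : X × Y)
    (h : 0 < (tensor C D).phi i b) : ∃ b', (tensor C D).f i b = some b' := by
  obtain ⟨x, y⟩ := b
  rw [tensor_phi hC hD] at h
  by_cases hl : FLeft C D i x y
  · obtain ⟨x', hx'⟩ := hC.exists_f i x (by unfold FLeft at hl; grind)
    exact ⟨(x', y), (tensor_f_eq_some hC).2 (Or.inl ⟨hl, hx', rfl⟩)⟩
  · obtain ⟨y', hy'⟩ := hD.exists_f i y (by unfold FLeft at hl; grind)
    exact ⟨(x, y'), (tensor_f_eq_some hC).2 (Or.inr ⟨hl, hy', rfl⟩)⟩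

theorem IsSeminormal.tensor (hC : C.IsSeminormal) (hD : D.IsSeminormal) :
    (tensor C D).IsSeminormal where
  string := fun i hi ⟨x, y⟩ => by
    have hx := hC.string i hi x
    have hy := hD.string i hi y
    rw [tensor_eps hC hD, tensor_phi hC hD, tensor_wt, coroot_add]
    split_ifs <;> omega
  odd := fun ⟨x, y⟩ => by
    have hx := hC.odd x
    have hy := hD.odd y
    rw [tensor_eps hC hD, tensor_phi hC hD, tensor_wt, coroot_add]
    split_ifs <;> omega
  f_iff_e _ := tensor_f_iff_e hC hD
  eps_of_e _ b b' h := (tensor_string_of_e hC hD b b' h).1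
  phi_of_e _ b b' h := (tensor_string_of_e hC hD b b' h).2
  wt_of_e _ := tensor_wt_of_e hC hD
  exists_e _ := tensor_exists_e hC hD
  exists_f _ := tensor_exists_f hC hD

theorem ELeft.of_tensor_right (hD : D.IsSeminormal) (hE : E.IsSeminormal) {z : Z}
    (h : ELeft C (tensor D E) i x (y, z)) : ELeft C D i x y := by
  unfold ELeft at *
  rw [tensor_eps hD hE, tensor_phi hD hE] at h
  grind

theorem ELeft.tensor_right (hD : D.IsSeminormal) (hE : E.IsSeminormal) {z : Z}
    (h : ELeft C D i x y) (hyz : ELeft D E i y z) : ELeft C (tensor D E) i x (y, z) := by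
  unfold ELeft at *
  rw [tensor_eps hD hE, tensor_phi hD hE]
  grind

/-- One half of the associativity of the tensor product: on `x ⊗ (y ⊗ z)` the operator `e_i` acts
either on `x ⊗ y` or on `z`. -/
theorem tensor_e_tensor (hC : C.IsSeminormal) (hD : D.IsSeminormal) (hE : E.IsSeminormal) {z z' : Z}
    (h : (tensor C (tensor D E)).e i (x, y, z) = some (x', y', z')) :
    (tensor C D).e i (x, y) = some (x', y') ∨ x' = x ∧ y' = y := by
  rw [tensor_e_eq_some hC, tensor_e_eq_some hD] at h
  rw [tensor_e_eq_some hC]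
  rcases h with ⟨hx, he, hyz⟩ | ⟨hx, ⟨hy, he, -⟩ | ⟨-, -, hy⟩, hxx⟩
  · exact Or.inl (Or.inl ⟨hx.of_tensor_right hD hE, he, congrArg Prod.fst hyz⟩)
  · exact Or.inl (Or.inr ⟨fun h => hx (h.tensor_right hD hE hy), he, hxx⟩)
  · exact Or.inr ⟨hxx, hy⟩

end Tensor

theorem isSeminormal_unit (X : Type*) : (unit X).IsSeminormal where
  string _ _ _ := by simp [unit, coroot_weight_zero]
  odd _ := by simp [unit, coroot_weight_zero]
  f_iff_e _ _ _ := by simp [unit]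
  eps_of_e _ _ _ h := by simp [unit] at h
  phi_of_e _ _ _ h := by simp [unit] at h
  wt_of_e _ _ _ h := by simp [unit] at h
  exists_e _ _ h := by simp [unit] at h
  exists_f _ _ h := by simp [unit] at h

theorem transport_e_eq_some {C : CrystalData X} {g : X ≃ Y} {i : ℤ} {y y' : Y} :
    (C.transport g).e i y = some y' ↔ C.e i (g.symm y) = some (g.symm y') := by
  simp only [transport, Option.map_eq_some_iff, ← Equiv.eq_symm_apply, exists_eq_right]

theorem transport_f_eq_some {C : CrystalData X} {g : X ≃ Y} {i : ℤ} {y y' : Y} :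
    (C.transport g).f i y = some y' ↔ C.f i (g.symm y) = some (g.symm y') := by
  simp only [transport, Option.map_eq_some_iff, ← Equiv.eq_symm_apply, exists_eq_right]

theorem IsSeminormal.transport {C : CrystalData X} (hC : C.IsSeminormal) (g : X ≃ Y) :
    (C.transport g).IsSeminormal where
  string i hi _ := hC.string i hi _
  odd _ := hC.odd _
  f_iff_e i _ _ := by rw [transport_e_eq_some, transport_f_eq_some, hC.f_iff_e]
  eps_of_e i _ _ h := hC.eps_of_e i _ _ (transport_e_eq_some.1 h)
  phi_of_e i _ _ h := hC.phi_of_e i _ _ (transport_e_eq_some.1 h)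
  wt_of_e i _ _ h := hC.wt_of_e i _ _ (transport_e_eq_some.1 h)
  exists_e i y h := (hC.exists_e i (g.symm y) h).imp' g fun _ hx =>
    transport_e_eq_some.2 (by rw [hx, g.symm_apply_apply])
  exists_f i y h := (hC.exists_f i (g.symm y) h).imp' g fun _ hx =>
    transport_f_eq_some.2 (by rw [hx, g.symm_apply_apply])

section TensorPow

variable {C : CrystalData X} {u : ℕ} {i : ℤ}

theorem IsSeminormal.tensorPow (hC : C.IsSeminormal) : ∀ u, (C.tensorPow u).IsSeminormal
  | 0 => isSeminormal_unit _
  | u + 1 => (hC.tensor (hC.tensorPow u)).transport _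

theorem tensorPow_wt (C : CrystalData X) (w : Fin u → X) :
    (C.tensorPow u).wt w = ∑ j, C.wt (w j) := by
  induction u with
  | zero => rfl
  | succ u ih =>
    rw [Fin.sum_univ_succ]
    exact congrArg (C.wt (w 0) + ·) (ih (Fin.tail w))

theorem tensorPow_succ_e_eq_some {w w' : Fin (u + 1) → X} :
    (C.tensorPow (u + 1)).e i w = some w' ↔
      (tensor C (C.tensorPow u)).e i (w 0, Fin.tail w) = some (w' 0, Fin.tail w') :=
  transport_e_eq_some

theorem tensor_tensorPow_succ_e_eq_some (hC : C.IsSeminormal) {x x' : X}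
    {w w' : Fin (u + 1) → X} :
    (tensor C (C.tensorPow (u + 1))).e i (x, w) = some (x', w') ↔
      (tensor C (tensor C (C.tensorPow u))).e i (x, w 0, Fin.tail w) =
        some (x', w' 0, Fin.tail w') := by
  have hw : w' = w ↔ (w' 0, Fin.tail w') = (w 0, Fin.tail w) :=
    (Fin.consEquiv fun _ : Fin (u + 1) => X).symm.injective.eq_iff.symm
  rw [tensor_e_eq_some hC, tensor_e_eq_some hC, tensorPow_succ_e_eq_some, hw]
  exact Iff.rfl

theorem tensorPow_e_factor (hC : C.IsSeminormal) {w w' : Fin u → X}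
    (h : (C.tensorPow u).e i w = some w') (j : Fin u) :
    C.e i (w j) = some (w' j) ∨ w' j = w j := by
  induction u with
  | zero => exact j.elim0
  | succ u ih =>
    rw [tensorPow_succ_e_eq_some, tensor_e_eq_some hC] at h
    rcases h with ⟨-, he, ht⟩ | ⟨-, he, h0⟩ <;> cases j using Fin.cases with
    | zero => tauto
    | succ j => first | exact Or.inr (congrFun ht j) | exact ih he j

theorem tensorPow_e_pair (hC : C.IsSeminormal) {w w' : Fin u → X}
    (h : (C.tensorPow u).e i w = some w') {j k : Fin u} (hjk : (k : ℕ) = j + 1) :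
    (tensor C C).e i (w j, w k) = some (w' j, w' k) ∨ w' j = w j ∧ w' k = w k := by
  induction u with
  | zero => exact j.elim0
  | succ u ih =>
    rw [tensorPow_succ_e_eq_some] at h
    obtain ⟨k, rfl⟩ := Fin.exists_succ_eq.2 (show k ≠ 0 by rintro rfl; simp at hjk)
    cases j using Fin.cases with
    | zero =>
      cases u with
      | zero => exact k.elim0
      | succ u =>
        obtain rfl : k = 0 := Fin.ext (by simpa using hjk)
        rw [tensor_tensorPow_succ_e_eq_some hC] at h
        exact tensor_e_tensor hC hC (hC.tensorPow u) h
    | succ j =>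
      rcases (tensor_e_eq_some hC).1 h with ⟨-, -, ht⟩ | ⟨-, he, -⟩
      · exact Or.inr ⟨congrFun ht j, congrFun ht k⟩
      · exact ih he (by simpa using hjk)

theorem tensorPow_f_factor (hC : C.IsSeminormal) {w w' : Fin u → X}
    (h : (C.tensorPow u).f i w = some w') (j : Fin u) :
    C.f i (w j) = some (w' j) ∨ w' j = w j := by
  rw [(hC.tensorPow u).f_iff_e] at h
  rw [hC.f_iff_e, eq_comm (a := w' j)]
  exact tensorPow_e_factor hC h j

theorem tensorPow_f_pair (hC : C.IsSeminormal) {w w' : Fin u → X}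
    (h : (C.tensorPow u).f i w = some w') {j k : Fin u} (hjk : (k : ℕ) = j + 1) :
    (tensor C C).f i (w j, w k) = some (w' j, w' k) ∨ w' j = w j ∧ w' k = w k := by
  rw [(hC.tensorPow u).f_iff_e] at h
  rw [(hC.tensor hC).f_iff_e, eq_comm (a := w' j), eq_comm (a := w' k)]
  exact tensorPow_e_pair hC h hjk

theorem tensorPow_eps_pos (hC : C.IsSeminormal) (hi : 0 < i) {w : Fin u → X} {j : Fin u}
    (hj : 0 < C.eps i (w j)) (h : ∀ k, j < k → coroot i (C.wt (w k)) ≤ 0) :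
    0 < (C.tensorPow u).eps i w := by
  induction u with
  | zero => exact j.elim0
  | succ u ih =>
    change 0 < (tensor C (C.tensorPow u)).eps i (w 0, Fin.tail w)
    rw [tensor_eps hC (hC.tensorPow u), if_neg hi.not_gt, if_pos hi]
    cases j using Fin.cases with
    | zero =>
      have htail : coroot i ((C.tensorPow u).wt (Fin.tail w)) ≤ 0 := by
        rw [tensorPow_wt, coroot_sum]
        exact Finset.sum_nonpos fun k _ => h k.succ k.succ_pos
      rw [← (hC.tensorPow u).string i hi.ne'] at htail
      omega
    | succ j =>
      have := ih (w := Fin.tail w) hj fun k hk => h k.succ (Fin.succ_lt_succ_iff.2 hk)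
      omega

end TensorPow

end CrystalData

namespace Word

theorem letter_lt_or (w : Word) {s t : ℕ} (h : s < t) :
    w.letter t < w.letter s ∨ w.letter t = w.letter s ∧ 0 ≤ w.letter s := by
  have hle := w.antitone (Nat.succ_le_of_lt h)
  have hmono := w.mono s
  have hdeg := w.degree_of_eq s
  rw [degree_eq_one] at hdeg
  rw [Nat.succ_eq_add_one] at hle
  omega

theorem finite_letter_eq (w : Word) (b : ℤ) : {k | w.letter k = b}.Finite := by
  obtain ⟨c, hc⟩ := w.charge
  obtain ⟨K, hK⟩ := Filter.eventually_atTop.1 hc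
  refine (Set.finite_Iio (K + (-b - c).toNat)).subset fun k (hk : w.letter k = b) => ?_
  by_contra hlt
  rw [Set.mem_Iio, not_lt] at hlt
  have := hK k (by omega)
  rw [bar] at this
  omega

/-- The number of occurrences of the letter `b`. -/
noncomputable def count (w : Word) (b : ℤ) : ℕ := {k | w.letter k = b}.ncard

theorem count_pos {w : Word} {b : ℤ} : 0 < w.count b ↔ ∃ k, w.letter k = b :=
  Set.ncard_pos (w.finite_letter_eq b)

theorem count_eq_zero {w : Word} {b : ℤ} : w.count b = 0 ↔ ∀ k, w.letter k ≠ b := by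
  rw [← not_iff_not, ← ne_eq, ← Nat.pos_iff_ne_zero, count_pos, not_forall_not]

theorem count_le_one (w : Word) {b : ℤ} (hb : b < 0) : w.count b ≤ 1 := by
  rw [count, Set.ncard_le_one (w.finite_letter_eq b)]
  intro s (hs : w.letter s = b) t (ht : w.letter t = b)
  rcases lt_trichotomy s t with h | h | h
  · have := w.letter_lt_or h; omega
  · exact h
  · have := w.letter_lt_or h; omega

theorem count_eq_sum_add (w : Word) (N : ℕ) (b : ℤ) :
    w.count b = (∑ k ∈ Finset.range N, if w.letter k = b then 1 else 0) +
      ({k | w.letter k = b} \ Set.Iio N).ncard := by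
  rw [count, ← Set.ncard_inter_add_ncard_sdiff_eq_ncard _ (Set.Iio N) (w.finite_letter_eq b),
    ← Finset.card_filter, ← Set.ncard_coe_finset]
  congr 2
  ext k
  simp [and_comm]

theorem wt_fst (w : Word) : w.wt.1 = 1 := rfl

theorem wt_snd (w : Word) (b : ℤ) : w.wt.2 b = w.count b - if b < 0 then 1 else 0 := by
  change w.mult b = _
  simp only [mult, count, degree]
  split_ifs <;> simp_all

theorem wt_sub_wt {v w : Word} {N : ℕ} (h : ∀ k, N ≤ k → v.letter k = w.letter k) :
    v.wt - w.wt = ∑ k ∈ Finset.range N,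
      ((0, Finsupp.single (v.letter k) 1 - Finsupp.single (w.letter k) 1) : Weight) := by
  refine Prod.ext ?_ (Finsupp.ext fun b => ?_)
  · simp [wt_fst, Prod.fst_sum]
  · have htail : {k | v.letter k = b} \ Set.Iio N = {k | w.letter k = b} \ Set.Iio N := by
      ext k
      simp only [Set.mem_sdiff, Set.mem_ofPred_eq, Set.mem_Iio, not_lt]
      exact and_congr_left fun hk => by rw [h k hk]
    rw [Prod.snd_sub, Prod.snd_sum, Finsupp.sub_apply, Finsupp.finsetSum_apply, wt_snd, wt_snd,
      count_eq_sum_add v N, count_eq_sum_add w N, htail]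
    simp only [Finsupp.sub_apply, Finsupp.single_apply, Finset.sum_sub_distrib]
    push_cast
    ring

theorem coroot_zero_wt (w : Word) : coroot 0 w.wt = w.count (-1) + w.count 0 := by
  simp [coroot_zero, wt_fst, wt_snd]

theorem coroot_wt {i : ℤ} (hi : i ≠ 0) (w : Word) :
    coroot i w.wt = w.count (i - 1) - w.count i := by
  rw [coroot_of_ne hi, wt_snd, wt_snd]
  split_ifs <;> omega

/-- `w'` arises from `w` by changing the letter at position `k` from `i` to `i - 1`. -/
structure LowersAt (i : ℤ) (k : ℕ) (w w' : Word) : Prop where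
  source : w.letter k = i
  target : w'.letter k = i - 1
  eq_of_ne : ∀ t, t ≠ k → w'.letter t = w.letter t

/-- `w'` arises from `w` by changing one letter `i` to `i - 1`; this describes the graph of `e_i`
without reference to signatures. -/
def Lowers (i : ℤ) (w w' : Word) : Prop := ∃ k, LowersAt i k w w'

section LowersAt

variable {i : ℤ} {k t : ℕ} {w w' : Word}

theorem LowersAt.letter_lt_source (h : LowersAt i k w w') (ht : k < t) : w.letter t < i := by
  have := w'.antitone ht.le
  rw [h.target, h.eq_of_ne t ht.ne'] at this
  omega

theorem LowersAt.target_lt_letter (h : LowersAt i k w w') (ht : t < k) :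
    i - 1 < w'.letter t := by
  have := w.antitone ht.le
  rw [h.source, ← h.eq_of_ne t ht.ne] at this
  omega

theorem LowersAt.letter_ne_target (h : LowersAt i k w w') (hi : i ≤ 0) (t : ℕ) :
    w.letter t ≠ i - 1 := by
  have hk := h.source
  rcases lt_trichotomy t k with ht | rfl | ht
  · have := w.antitone ht.le
    omega
  · omega
  · have hlt := w'.letter_lt_or ht
    rw [h.target, h.eq_of_ne t ht.ne'] at hlt
    omega

theorem LowersAt.letter_ne_source (h : LowersAt i k w w') (hi : i < 0) (t : ℕ) :
    w'.letter t ≠ i := by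
  have hk := h.target
  rcases lt_trichotomy t k with ht | rfl | ht
  · have hlt := w.letter_lt_or ht
    rw [h.source, ← h.eq_of_ne t ht.ne] at hlt
    omega
  · omega
  · have := w'.antitone ht.le
    omega

theorem Lowers.unique_right {w₁ w₂ : Word} (h₁ : Lowers i w w₁) (h₂ : Lowers i w w₂) :
    w₁ = w₂ := by
  obtain ⟨k, h₁⟩ := h₁
  obtain ⟨l, h₂⟩ := h₂
  obtain rfl : k = l := le_antisymm (not_lt.1 fun h => (h₂.letter_lt_source h).ne h₁.source)
    (not_lt.1 fun h => (h₁.letter_lt_source h).ne h₂.source)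
  ext t
  rcases eq_or_ne t k with rfl | ht
  · rw [h₁.target, h₂.target]
  · rw [h₁.eq_of_ne t ht, h₂.eq_of_ne t ht]

theorem Lowers.unique_left {w₁ w₂ : Word} (h₁ : Lowers i w₁ w) (h₂ : Lowers i w₂ w) :
    w₁ = w₂ := by
  obtain ⟨k, h₁⟩ := h₁
  obtain ⟨l, h₂⟩ := h₂
  obtain rfl : k = l := le_antisymm (not_lt.1 fun h => (h₁.target_lt_letter h).ne' h₂.target)
    (not_lt.1 fun h => (h₂.target_lt_letter h).ne' h₁.target)
  ext t
  rcases eq_or_ne t k with rfl | ht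
  · rw [h₁.source, h₂.source]
  · rw [← h₁.eq_of_ne t ht, ← h₂.eq_of_ne t ht]

theorem Lowers.wt_eq (h : Lowers i w w') : w'.wt = w.wt + simpleRoot i := by
  obtain ⟨k, h⟩ := h
  rw [← sub_eq_iff_eq_add', wt_sub_wt fun t ht => h.eq_of_ne t (Nat.lt_of_succ_le ht).ne',
    Finset.sum_eq_single_of_mem k (Finset.self_mem_range_succ k), h.source, h.target]
  · rfl
  · intro t _ ht
    rw [h.eq_of_ne t ht, sub_self, Prod.mk_zero_zero]

theorem Lowers.count_eq (h : Lowers i w w') (b : ℤ) :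
    (w'.count b : ℤ) = w.count b + (if b = i - 1 then 1 else 0) - (if b = i then 1 else 0) := by
  have := DFunLike.congr_fun (congrArg Prod.snd h.wt_eq) b
  rw [Prod.snd_add, Finsupp.add_apply, wt_snd, wt_snd, simpleRoot, root_apply] at this
  omega

theorem Lowers.hasCharge_iff (h : Lowers i w w') (c : ℤ) :
    HasCharge w'.letter c ↔ HasCharge w.letter c := by
  obtain ⟨k, h⟩ := h
  refine Filter.eventually_congr ?_
  filter_upwards [Filter.eventually_gt_atTop k] with l hl
  rw [h.eq_of_ne l hl.ne']

theorem isSignature_self (hi : i ≠ 0)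
    (h : i < 0 → ∀ s s', s' < s → ¬(w.letter s = i - 1 ∧ w.letter s' = i)) :
    IsSignature i (fun j => sgn i (w.letter j)) (fun j => sgn i (w.letter j)) := by
  refine ⟨fun hn => ⟨Relation.ReflTransGen.refl, ?_⟩,
    fun _ => ⟨Relation.ReflTransGen.refl, w.no_minus_plus i⟩, fun h0 => absurd h0 hi⟩
  simpa only [sgn_eq_plus, sgn_eq_minus] using h hn

open Classical in
theorem isSignature_zero (σ : ℕ → Sgn) : IsSignature 0 σ
    (fun k => if ∀ l, k < l → σ l = Sgn.dot then σ k else Sgn.dot) :=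
  ⟨fun h => absurd h (lt_irrefl _), fun h => absurd h (lt_irrefl _), fun _ _ => rfl⟩

theorem LowersAt.isGoodMinus (h : LowersAt i k w w') : IsGoodMinus i w.letter k := by
  rcases eq_or_ne i 0 with rfl | hi
  · refine ⟨_, isSignature_zero _, ?_, fun h => absurd h (lt_irrefl _),
      fun h => absurd h (lt_irrefl _)⟩
    rw [if_pos fun l hl => sgn_eq_dot.2 ⟨h.letter_ne_target le_rfl l, (h.letter_lt_source hl).ne⟩,
      sgn_eq_minus, h.source]
  · refine ⟨_, isSignature_self hi fun hn s _ _ hs => h.letter_ne_target hn.le s hs.1,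
      sgn_eq_minus.2 h.source, fun hn l hl => ?_, fun _ l hl => ?_⟩ <;> rw [Ne, sgn_eq_minus]
    · have hlt := w.letter_lt_or hl
      rw [h.source] at hlt
      omega
    · exact (h.letter_lt_source hl).ne

theorem LowersAt.isGoodPlus (h : LowersAt i k w w') : IsGoodPlus i w'.letter k := by
  have hlt : i ≤ 0 → ∀ l, k < l → w'.letter l < i - 1 := fun hi l hl => by
    have := w'.letter_lt_or hl
    rw [h.target] at this
    omega
  rcases eq_or_ne i 0 with rfl | hi
  · refine ⟨_, isSignature_zero _, ?_, fun h => absurd h (lt_irrefl _),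
      fun h => absurd h (lt_irrefl _)⟩
    rw [if_pos fun l hl => sgn_eq_dot.2 ?_, sgn_eq_plus, h.target]
    have := hlt le_rfl l hl
    omega
  · refine ⟨_, isSignature_self hi fun hn _ s' _ hs => h.letter_ne_source hn s' hs.2,
      sgn_eq_plus.2 h.target, fun hn l hl => ?_, fun _ l hl => ?_⟩ <;> rw [Ne, sgn_eq_plus]
    · exact (hlt hn.le l hl).ne
    · exact (h.target_lt_letter hl).ne'

theorem eOp_eq_some_iff : eOp i w = some w' ↔ Lowers i w w' := by
  have hlowers (k : ℕ) (hk : IsGoodMinus i w.letter k) : Lowers i w (w.applyE i k hk) :=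
    ⟨k, goodMinus_letter hk, by simp [applyE, replace],
      fun t ht => by simp [applyE, replace, ht]⟩
  unfold eOp
  constructor <;> intro h
  · split_ifs at h with hgood
    obtain rfl := Option.some_inj.1 h
    exact hlowers _ _
  · obtain ⟨k, hk⟩ := id h
    rw [dif_pos ⟨k, hk.isGoodMinus⟩, Option.some_inj]
    exact (hlowers _ _).unique_right h

theorem fOp_eq_some_iff : fOp i w = some w' ↔ Lowers i w' w := by
  have hlowers (k : ℕ) (hk : IsGoodPlus i w.letter k) : Lowers i (w.applyF i k hk) w :=
    ⟨k, by simp [applyF, replace], goodPlus_letter hk,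
      fun t ht => by simp [applyF, replace, ht]⟩
  unfold fOp
  constructor <;> intro h
  · split_ifs at h with hgood
    obtain rfl := Option.some_inj.1 h
    exact hlowers _ _
  · obtain ⟨k, hk⟩ := id h
    rw [dif_pos ⟨k, hk.isGoodPlus⟩, Option.some_inj]
    exact (hlowers _ _).unique_left h

end LowersAt

section Crystal

variable {i : ℤ} {w w' : Word}

/-- The value of `ε_i` in terms of multiplicities. -/
noncomputable def epsCount (i : ℤ) (w : Word) : ℕ :=
  if i ≤ 0 then (if 0 < w.count i ∧ w.count (i - 1) = 0 then 1 else 0) else w.count i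

/-- The value of `φ_i` in terms of multiplicities. -/
noncomputable def phiCount (i : ℤ) (w : Word) : ℕ :=
  if i < 0 then (if 0 < w.count (i - 1) ∧ w.count i = 0 then 1 else 0) else w.count (i - 1)

theorem Lowers.epsCount_eq (h : Lowers i w w') : epsCount i w = epsCount i w' + 1 := by
  have hcount := h.count_eq i
  have hpred := h.count_eq (i - 1)
  have hle : i ≤ 0 → w'.count (i - 1) ≤ 1 := fun hi => w'.count_le_one (by omega)
  unfold epsCount
  split_ifs at * <;> omega

theorem Lowers.phiCount_eq (h : Lowers i w w') : phiCount i w' = phiCount i w + 1 := by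
  have hcount := h.count_eq i
  have hpred := h.count_eq (i - 1)
  have hle : i < 0 → w.count i ≤ 1 := w.count_le_one
  unfold phiCount
  split_ifs at * <;> omega

theorem exists_lowers_of_epsCount_pos (h : 0 < epsCount i w) : ∃ w', Lowers i w w' := by
  have hpos : 0 < w.count i ∧ (i ≤ 0 → w.count (i - 1) = 0) := by
    unfold epsCount at h
    split_ifs at h <;> omega
  obtain ⟨k, hk : w.letter k = i, hmax⟩ :=
    Set.exists_max_image {k | w.letter k = i} id (w.finite_letter_eq i) (count_pos.1 hpos.1)
  have hnext : w.letter (k + 1) ≠ i := fun h' => (Nat.lt_succ_self k).not_ge (hmax (k + 1) h')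
  have hmono := w.mono k
  refine ⟨w.replace k (i - 1) (by omega) (fun h' => ?_) ?_ ?_, k, hk, by simp [replace],
    fun t ht => by simp [replace, ht]⟩
  · by_contra hlt
    exact count_eq_zero.1 (hpos.2 (by omega)) _ h'
  all_goals
    rintro j rfl
    have := w.mono j
    omega

theorem exists_lowers_of_phiCount_pos (h : 0 < phiCount i w) : ∃ w', Lowers i w' w := by
  have hpos : 0 < w.count (i - 1) ∧ (i < 0 → w.count i = 0) := by
    unfold phiCount at h
    split_ifs at h <;> omega
  obtain ⟨k, hk : w.letter k = i - 1, hmin⟩ := Set.exists_min_image {k | w.letter k = i - 1} id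
    (w.finite_letter_eq (i - 1)) (count_pos.1 hpos.1)
  have hmono := w.mono k
  have hprev : ∀ j, j + 1 = k → i ≤ w.letter j := by
    rintro j rfl
    have hle := w.mono j
    have hne : w.letter j ≠ i - 1 := fun h' => (Nat.lt_succ_self j).not_ge (hmin j h')
    omega
  refine ⟨w.replace k i (by omega) (by omega) hprev fun j _ h' => ?_, k, by simp [replace], hk,
    fun t ht => by simp [replace, ht]⟩
  by_contra hlt
  exact count_eq_zero.1 (hpos.2 (by omega)) j h'.symm

theorem maxIter_eq {X : Type*} {g : X → Option X} {N : X → ℕ}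
    (hpos : ∀ x, 0 < N x → ∃ y, g x = some y) (hstep : ∀ x y, g x = some y → N x = N y + 1)
    (x : X) : maxIter g x = N x := by
  have hnone (k : ℕ) : (fun y : Option X => y.bind g)^[k] none = none :=
    Function.iterate_fixed rfl k
  have hiter (k : ℕ) (x : X) :
      (fun y : Option X => y.bind g)^[k] (some x) ≠ none ↔ k ≤ N x := by
    induction k generalizing x with
    | zero => simp
    | succ k ih =>
      rw [Function.iterate_succ_apply, Option.bind_some]
      cases hg : g x with
      | none =>
        have : ¬ 0 < N x := fun h => by
          obtain ⟨y, hy⟩ := hpos x h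
          simp [hg] at hy
        simp only [hnone, ne_eq, not_true_eq_false, false_iff]
        omega
      | some y =>
        rw [ih, hstep x y hg]
        omega
  rw [maxIter, Set.ext fun k => hiter k x]
  exact csSup_Iic

theorem crystal_eps (i : ℤ) (w : Word) : crystal.eps i w = epsCount i w :=
  maxIter_eq (g := eOp i) (N := epsCount i)
    (fun _ h => (exists_lowers_of_epsCount_pos h).imp fun _ => eOp_eq_some_iff.2)
    (fun _ _ h => (eOp_eq_some_iff.1 h).epsCount_eq) w

theorem crystal_phi (i : ℤ) (w : Word) : crystal.phi i w = phiCount i w :=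
  maxIter_eq (g := fOp i) (N := phiCount i)
    (fun _ h => (exists_lowers_of_phiCount_pos h).imp fun _ => fOp_eq_some_iff.2)
    (fun _ _ h => (fOp_eq_some_iff.1 h).phiCount_eq) w

theorem isSeminormal_crystal : crystal.IsSeminormal where
  string i hi w := by
    have hle : i ≤ 0 → w.count (i - 1) ≤ 1 := fun hi => w.count_le_one (by omega)
    have hle' : i < 0 → w.count i ≤ 1 := w.count_le_one
    rw [crystal_eps, crystal_phi, show crystal.wt = wt from rfl, coroot_wt hi]
    unfold epsCount phiCount
    split_ifs <;> omega
  odd w := by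
    have hle := w.count_le_one (b := -1) (by omega)
    rw [crystal_eps, crystal_phi, show crystal.wt = wt from rfl, coroot_zero_wt]
    simp only [epsCount, phiCount, le_refl, lt_irrefl, if_true, if_false, zero_sub]
    split_ifs <;> omega
  f_iff_e _ _ _ := fOp_eq_some_iff.trans eOp_eq_some_iff.symm
  eps_of_e i w w' h := by
    rw [crystal_eps, crystal_eps, (eOp_eq_some_iff.1 h).epsCount_eq]
  phi_of_e i w w' h := by
    rw [crystal_phi, crystal_phi, (eOp_eq_some_iff.1 h).phiCount_eq]
  wt_of_e _ _ _ h := (eOp_eq_some_iff.1 h).wt_eq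
  exists_e i w h := by
    rw [crystal_eps] at h
    exact (exists_lowers_of_epsCount_pos h).imp fun _ => eOp_eq_some_iff.2
  exists_f i w h := by
    rw [crystal_phi] at h
    exact (exists_lowers_of_phiCount_pos h).imp fun _ => fOp_eq_some_iff.2

end Crystal

section Adjacent

open CrystalData

variable {d k : ℕ} {i : ℤ} {x x' y y' : Word}

/-- The condition for `x` and `y` to be adjacent columns of a tableau, `d` being the difference of
their charges. -/
def Adjacent (d : ℕ) (x y : Word) : Prop :=
  ∀ k, y.letter (k + d) ≤ x.letter k ∧ (x.letter k = y.letter (k + d) → degree (x.letter k) = 0)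

theorem adjacent_iff : Adjacent d x y ↔
    ∀ k, y.letter (k + d) < x.letter k ∨ y.letter (k + d) = x.letter k ∧ x.letter k < 0 := by
  refine forall_congr' fun k => ?_
  unfold degree
  grind

theorem Adjacent.lt_or (h : Adjacent d x y) (k : ℕ) :
    y.letter (k + d) < x.letter k ∨ y.letter (k + d) = x.letter k ∧ x.letter k < 0 :=
  adjacent_iff.1 h k

theorem Adjacent.lowers_right (h : Adjacent d x y) (hy : Lowers i y y') : Adjacent d x y' := by
  obtain ⟨l, hy⟩ := hy
  refine adjacent_iff.2 fun k => ?_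
  have hk := h.lt_or k
  rcases eq_or_ne (k + d) l with rfl | hne
  · rw [hy.source] at hk
    rw [hy.target]
    omega
  · rwa [hy.eq_of_ne _ hne]

theorem Adjacent.raises_left (h : Adjacent d x' y) (hx : Lowers i x x') : Adjacent d x y := by
  obtain ⟨l, hx⟩ := hx
  refine adjacent_iff.2 fun k => ?_
  have hk := h.lt_or k
  rcases eq_or_ne k l with rfl | hne
  · rw [hx.target] at hk
    rw [hx.source]
    omega
  · rwa [← hx.eq_of_ne k hne]

theorem Adjacent.lowersAt_left (h : Adjacent d x y) (hx : LowersAt i k x x')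
    (hneg : i < 0 → y.letter (k + d) ≠ i) (hpos : 0 < i → y.letter (k + d) ≠ i - 1) :
    Adjacent d x' y := by
  refine adjacent_iff.2 fun t => ?_
  have ht := h.lt_or t
  rcases eq_or_ne t k with rfl | hne
  · rw [hx.source] at ht
    rw [hx.target]
    omega
  · rwa [hx.eq_of_ne t hne]

theorem Adjacent.raisesAt_right (h : Adjacent d x y') (hy : LowersAt i k y y')
    (hneg : i ≤ 0 → ∀ t, t + d = k → x.letter t ≠ i - 1)
    (hpos : 0 ≤ i → ∀ t, t + d = k → x.letter t ≠ i) : Adjacent d x y := by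
  refine adjacent_iff.2 fun t => ?_
  have ht := h.lt_or t
  rcases eq_or_ne (t + d) k with htk | hne
  · rw [htk, hy.target] at ht
    rw [htk, hy.source]
    have hne := fun hi => hneg hi t htk
    have hne' := fun hi => hpos hi t htk
    omega
  · rwa [← hy.eq_of_ne _ hne]

theorem Adjacent.right_ne_pred (h : Adjacent d x y) (hx : LowersAt i k x x') (hi : i < 0)
    (hy : y.letter (k + d) = i) (s : ℕ) : y.letter s ≠ i - 1 := by
  intro hs
  have hks : k + d < s := by
    by_contra hle
    have := y.antitone (not_lt.1 hle)
    omega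
  have hle := y.antitone (show k + 1 + d ≤ s by omega)
  have hadj := h.lt_or (k + 1)
  have hlt := hx.letter_lt_source k.lt_add_one
  have hne := hx.letter_ne_target hi.le (k + 1)
  omega

theorem Adjacent.count_le_count_pred (h : Adjacent d x y) (hx : LowersAt i k x x') (hi : 0 < i)
    (hy : y.letter (k + d) = i - 1) : x.count i ≤ y.count (i - 1) := by
  refine Set.ncard_le_ncard_of_injOn (· + d) (fun s (hs : x.letter s = i) => ?_)
    (add_left_injective d).injOn (y.finite_letter_eq _)
  have hsk : s ≤ k := not_lt.1 fun hks => (hx.letter_lt_source hks).ne hs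
  have hle := y.antitone (Nat.add_le_add_right hsk d)
  have hadj := h.lt_or s
  rw [Set.mem_ofPred_eq]
  omega

theorem Adjacent.left_ne_source (h : Adjacent d x y') (hy : LowersAt i (k + d) y y') (hi : i < 0)
    (hx : x.letter k = i - 1) (s : ℕ) : x.letter s ≠ i := by
  intro hs
  have hsk : s < k := by
    by_contra hle
    have := x.antitone (not_lt.1 hle)
    omega
  have hle := x.antitone (show s ≤ k - 1 by omega)
  have hadj := h.lt_or (k - 1)
  have hlt := hy.target_lt_letter (show k - 1 + d < k + d by omega)
  have hne := hy.letter_ne_source hi (k - 1 + d)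
  omega

theorem Adjacent.count_pred_le_count (h : Adjacent d x y') (hy : LowersAt i (k + d) y y')
    (hi : 0 < i) (hx : x.letter k = i) : y'.count (i - 1) ≤ x.count i := by
  have hge : ∀ s, y'.letter s = i - 1 → k + d ≤ s := fun s hs =>
    not_lt.1 fun hlt => (hy.target_lt_letter hlt).ne' hs
  refine Set.ncard_le_ncard_of_injOn (· - d) (fun s (hs : y'.letter s = i - 1) => ?_) ?_
    (x.finite_letter_eq _)
  · have hks := hge s hs
    have hle := x.antitone (show k ≤ s - d by omega)
    have hadj := h.lt_or (s - d)
    rw [Nat.sub_add_cancel (by omega)] at hadj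
    rw [Set.mem_ofPred_eq]
    omega
  · intro s hs t ht (hst : s - d = t - d)
    have hks := hge s hs
    have hkt := hge t ht
    omega

theorem Adjacent.lowers_left (h : Adjacent d x y) (hx : Lowers i x x')
    (hl : ELeft crystal crystal i x y) : Adjacent d x' y := by
  obtain ⟨k, hx⟩ := hx
  unfold ELeft at hl
  rw [crystal_eps, crystal_phi, crystal_phi, crystal_eps] at hl
  refine h.lowersAt_left hx (fun hi hy => ?_) fun hi hy => ?_
  · have hle := hl.1 hi
    rw [epsCount, if_pos hi.le, if_pos ⟨count_pos.2 ⟨_, hy⟩,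
      count_eq_zero.2 (h.right_ne_pred hx hi hy)⟩, phiCount, if_pos hi,
      if_neg fun h => h.1.ne' (count_eq_zero.2 (hx.letter_ne_target hi.le))] at hle
    omega
  · have hlt := hl.2.1 hi
    rw [phiCount, if_neg hi.not_gt, epsCount, if_neg hi.not_ge] at hlt
    exact hlt.not_ge (h.count_le_count_pred hx hi hy)

theorem eps_zero_add_phi_zero_pos (h : 0 < x.count (-1) ∨ 0 < x.count 0) :
    0 < crystal.eps 0 x + crystal.phi 0 x := by
  rw [← isSeminormal_crystal.coroot_zero_pos_iff, show crystal.wt x = x.wt from rfl,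
    coroot_zero_wt]
  omega

theorem Adjacent.raises_right (h : Adjacent d x y') (hy : Lowers i y y')
    (hl : ¬ FLeft crystal crystal i x y') : Adjacent d x y := by
  obtain ⟨k, hy⟩ := hy
  refine h.raisesAt_right hy ?_ ?_ <;> rintro hi t rfl hx <;> have hpos := count_pos.2 ⟨t, hx⟩ <;>
    refine hl ⟨fun hn => ?_, fun hp => ?_, ?_⟩
  · have hne := h.left_ne_source hy hn hx
    rw [crystal_eps, crystal_phi, epsCount, if_pos hi,
      if_neg fun h => h.1.ne' (count_eq_zero.2 (hy.letter_ne_source hn)), phiCount, if_pos hn,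
      if_pos ⟨hpos, count_eq_zero.2 hne⟩]
    exact zero_lt_one
  · exact absurd hp hi.not_gt
  · rintro rfl
    exact eps_zero_add_phi_zero_pos (Or.inl hpos)
  · exact absurd hn hi.not_gt
  · rw [crystal_phi, crystal_eps, phiCount, if_neg hi.not_gt, epsCount, if_neg hp.not_ge]
    exact h.count_pred_le_count hy hp hx
  · rintro rfl
    exact eps_zero_add_phi_zero_pos (Or.inr hpos)

theorem Adjacent.of_tensor_e (h : Adjacent d x y)
    (he : (tensor crystal crystal).e i (x, y) = some (x', y')) : Adjacent d x' y' := by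
  rcases (tensor_e_eq_some isSeminormal_crystal).1 he with ⟨hl, hx, rfl⟩ | ⟨-, hy, rfl⟩
  · exact h.lowers_left (eOp_eq_some_iff.1 hx) hl
  · exact h.lowers_right (eOp_eq_some_iff.1 hy)

theorem Adjacent.of_tensor_f (h : Adjacent d x y)
    (hf : (tensor crystal crystal).f i (x, y) = some (x', y')) : Adjacent d x' y' := by
  rcases (tensor_f_eq_some isSeminormal_crystal).1 hf with ⟨-, hx, rfl⟩ | ⟨hl, hy, rfl⟩
  · exact h.raises_left (fOp_eq_some_iff.1 hx)
  · exact h.raises_right (fOp_eq_some_iff.1 hy) hl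

end Adjacent

end Word

open Word CrystalData

variable {u : ℕ} {lam : Fin u → ℤ} {w : Fin u → Word}

theorem mem_tableaux : w ∈ tableaux lam ↔ (∀ j, HasCharge (w j).letter (lam j)) ∧
    ∀ j k : Fin u, (k : ℕ) = j + 1 → Adjacent (lam j - lam k).toNat (w j) (w k) :=
  Iff.rfl

theorem mem_tableaux_of_e (hw : w ∈ tableaux lam) {i : ℤ} {w' : Fin u → Word}
    (h : (crystal.tensorPow u).e i w = some w') : w' ∈ tableaux lam := by
  rw [mem_tableaux] at hw ⊢
  refine ⟨fun j => ?_, fun j k hjk => ?_⟩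
  · rcases tensorPow_e_factor isSeminormal_crystal h j with he | hj
    · exact ((eOp_eq_some_iff.1 he).hasCharge_iff _).2 (hw.1 j)
    · exact hj ▸ hw.1 j
  · rcases tensorPow_e_pair isSeminormal_crystal h hjk with he | ⟨hj, hk⟩
    · exact (hw.2 j k hjk).of_tensor_e he
    · exact hj ▸ hk ▸ hw.2 j k hjk

theorem mem_tableaux_of_f (hw : w ∈ tableaux lam) {i : ℤ} {w' : Fin u → Word}
    (h : (crystal.tensorPow u).f i w = some w') : w' ∈ tableaux lam := by
  rw [mem_tableaux] at hw ⊢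
  refine ⟨fun j => ?_, fun j k hjk => ?_⟩
  · rcases tensorPow_f_factor isSeminormal_crystal h j with hf | hj
    · exact ((fOp_eq_some_iff.1 hf).hasCharge_iff _).1 (hw.1 j)
    · exact hj ▸ hw.1 j
  · rcases tensorPow_f_pair isSeminormal_crystal h hjk with hf | ⟨hj, hk⟩
    · exact (hw.2 j k hjk).of_tensor_f hf
    · exact hj ▸ hk ▸ hw.2 j k hjk

theorem isStable_tableaux (lam : Fin u → ℤ) : (crystal.tensorPow u).IsStable (tableaux lam) :=
  fun _ _ hw => ⟨fun _ => mem_tableaux_of_e hw, fun _ => mem_tableaux_of_f hw⟩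

namespace Word

variable {v w : Word} {c : ℤ}

theorem exists_letter_eq (hv : HasCharge v.letter c) (hw : HasCharge w.letter c) :
    ∃ N, ∀ k, N ≤ k → v.letter k = w.letter k :=
  Filter.eventually_atTop.1 (hv.mp (hw.mono fun _ hk hk' => hk'.trans hk.symm))

theorem weightLE_wt (hv : HasCharge v.letter c) (hw : HasCharge w.letter c)
    (h : ∀ k, v.letter k ≤ w.letter k) : WeightLE w.wt v.wt := by
  obtain ⟨N, hN⟩ := exists_letter_eq hv hw
  rw [WeightLE, wt_sub_wt hN]
  exact AddSubmonoid.sum_mem _ fun k _ => single_sub_single_mem_closure (h k)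

theorem eq_of_height_le (hv : HasCharge v.letter c) (hw : HasCharge w.letter c)
    (h : ∀ k, v.letter k ≤ w.letter k) (hheight : height v.wt ≤ height w.wt) : v = w := by
  obtain ⟨N, hN⟩ := exists_letter_eq hv hw
  have hsum : ∑ k ∈ Finset.range N, (w.letter k - v.letter k) = 0 := by
    refine le_antisymm ?_ (Finset.sum_nonneg fun k _ => sub_nonneg.2 (h k))
    rw [← sub_nonpos, ← map_sub, wt_sub_wt hN, map_sum] at hheight
    simpa only [height_single_sub_single] using hheight
  rw [Finset.sum_eq_zero_iff_of_nonneg fun k _ => sub_nonneg.2 (h k)] at hsum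
  ext k
  rcases lt_or_ge k N with hk | hk
  · exact (sub_eq_zero.1 (hsum k (Finset.mem_range.2 hk))).symm
  · exact hN k hk

theorem le_letter (hw : HasCharge w.letter c) (k : ℕ) : min 0 (-(k + 1 + c)) ≤ w.letter k := by
  obtain ⟨N, hN⟩ := Filter.eventually_atTop.1 hw
  rcases le_total N k with hk | hk
  · rw [hN k hk, bar]
    omega
  · induction hk using Nat.decreasingInduction with
    | self =>
      rw [hN N le_rfl, bar]
      omega
    | of_succ k _ ih =>
      have hlt := w.letter_lt_or k.lt_add_one
      push_cast at ih
      omega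

/-- The word of charge `c` with letters `\overline{r + 1}` in the rows `r ≥ K` and letters `b` in
the rows `r < K`; here position `k` of a word of charge `c` lies in row `k + c`. -/
def fill (K : ℕ) (c : ℤ) (b : ℕ) : Word where
  letter k := if k + c < K then b else bar (k + 1 + c)
  mono k := by
    simp only [bar]; push_cast; split_ifs <;> omega
  degree_of_eq k := by
    simp only [bar, degree]; push_cast; split_ifs <;> omega
  charge := by
    refine ⟨c, ?_⟩
    filter_upwards [Filter.eventually_ge_atTop (K - c).toNat] with k hk
    exact if_neg (by omega)

theorem hasCharge_fill (K : ℕ) (c : ℤ) (b : ℕ) : HasCharge (fill K c b).letter c := by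
  filter_upwards [Filter.eventually_ge_atTop (K - c).toNat] with k hk
  exact if_neg (by omega)

theorem fill_letter (K : ℕ) (c : ℤ) (b k : ℕ) :
    (fill K c b).letter k = if k + c < K then (b : ℤ) else -(k + 1 + c) := rfl

end Word

/-- The least tableau among those with letters `\overline{r + 1}` in the rows `r ≥ K` and unbarred
letters in the rows `r < K`. -/
def least (K : ℕ) (lam : Fin u → ℤ) : Fin u → Word := fun j => fill K (lam j) j.rev

theorem highest_eq_least (lam : Fin u → ℤ) : highest lam = least 0 lam := by
  funext j
  ext k
  simp only [highest, hwWord, least, fill_letter, unbar, bar, Fin.val_rev]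
  split_ifs <;> omega

theorem least_mem_tableaux (K : ℕ) (hlam : Antitone lam) : least K lam ∈ tableaux lam := by
  refine mem_tableaux.2 ⟨fun j => hasCharge_fill _ _ _, fun i j hij => adjacent_iff.2 fun k => ?_⟩
  have hle := hlam (show i ≤ j by rw [Fin.le_def]; omega)
  simp only [least, fill_letter, Fin.val_rev]
  push_cast
  split_ifs <;> omega

theorem rev_le_letter {K : ℕ} (hlam : Antitone lam) (hw : w ∈ tableaux lam)
    (h : ∀ j (k : ℕ), k + lam j < K → 0 ≤ (w j).letter k) (j : Fin u) (k : ℕ)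
    (hk : k + lam j < K) : (j.rev : ℤ) ≤ (w j).letter k := by
  induction hn : (j.rev : ℕ) generalizing j k with
  | zero => exact h j k hk
  | succ n ih =>
    rw [Fin.val_rev] at hn
    let j' : Fin u := ⟨j + 1, by omega⟩
    have hle : lam j' ≤ lam j := hlam (Nat.le_succ j)
    have hnext := ih j' (k + (lam j - lam j').toNat) (by omega) (by rw [Fin.val_rev]; grind)
    have hadj := ((mem_tableaux.1 hw).2 j j' rfl).lt_or k
    have hnonneg := h j k hk
    omega

theorem least_le {K : ℕ} (hlam : Antitone lam) (hw : w ∈ tableaux lam)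
    (h : ∀ j (k : ℕ), k + lam j < K → 0 ≤ (w j).letter k) (j : Fin u) (k : ℕ) :
    (least K lam j).letter k ≤ (w j).letter k := by
  rw [least, fill_letter]
  split_ifs with hk
  · exact rev_le_letter hlam hw h j k hk
  · have := le_letter ((mem_tableaux.1 hw).1 j) k
    omega

theorem highest_mem_tableaux (hlam : Antitone lam) : highest lam ∈ tableaux lam :=
  highest_eq_least lam ▸ least_mem_tableaux 0 hlam

theorem highest_le (hlam : Antitone lam) (hw : w ∈ tableaux lam) (j : Fin u) (k : ℕ) :
    (highest lam j).letter k ≤ (w j).letter k := by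
  rw [highest_eq_least]
  refine least_le hlam hw (fun j k hk => ?_) j k
  have := le_letter ((mem_tableaux.1 hw).1 j) k
  omega

theorem weightLE_tensorPow_wt {v : Fin u → Word} (hv : v ∈ tableaux lam) (hw : w ∈ tableaux lam)
    (h : ∀ j k, (v j).letter k ≤ (w j).letter k) :
    WeightLE ((crystal.tensorPow u).wt w) ((crystal.tensorPow u).wt v) := by
  rw [tensorPow_wt, tensorPow_wt, WeightLE, ← Finset.sum_sub_distrib]
  exact AddSubmonoid.sum_mem _ fun j _ => weightLE_wt (hv.1 j) (hw.1 j) (h j)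

theorem eq_of_height_tensorPow_le {v : Fin u → Word} (hv : v ∈ tableaux lam)
    (hw : w ∈ tableaux lam) (h : ∀ j k, (v j).letter k ≤ (w j).letter k)
    (hheight : height ((crystal.tensorPow u).wt v) ≤ height ((crystal.tensorPow u).wt w)) :
    v = w := by
  rw [tensorPow_wt, tensorPow_wt, map_sum, map_sum] at hheight
  have hle : ∀ j ∈ Finset.univ, height (w j).wt ≤ height (v j).wt := fun j _ =>
    (weightLE_wt (hv.1 j) (hw.1 j) (h j)).height_le
  have heq := (Finset.sum_eq_sum_iff_of_le hle).1 (le_antisymm (Finset.sum_le_sum hle) hheight)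
  exact funext fun j => eq_of_height_le (hv.1 j) (hw.1 j) (h j) (heq j (Finset.mem_univ j)).ge

theorem isHighestWeight_iff (hlam : Antitone lam) (w : Fin u → Word) :
    (crystal.tensorPow u).IsHighestWeight (tableaux lam) w ↔ w = highest lam := by
  have hmem := highest_mem_tableaux hlam
  constructor
  · rintro ⟨hw, h⟩
    exact (eq_of_height_tensorPow_le hmem hw (highest_le hlam hw) (h _ hmem).height_le).symm
  · rintro rfl
    exact ⟨hmem, fun w hw => weightLE_tensorPow_wt hmem hw (highest_le hlam hw)⟩

theorem exists_eqvGen_of_descent {α : Type*} {r : α → α → Prop} {T : Set α} {terminal : α → Prop}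
    (N : α → ℕ) (step : ∀ a ∈ T, ¬ terminal a → ∃ b ∈ T, Relation.EqvGen r a b ∧ N b < N a)
    {a : α} (ha : a ∈ T) : ∃ b ∈ T, Relation.EqvGen r a b ∧ terminal b := by
  induction hn : N a using Nat.strong_induction_on generalizing a with
  | h n ih =>
    by_cases hterminal : terminal a
    · exact ⟨a, ha, .refl a, hterminal⟩
    · obtain ⟨b, hb, hab, hlt⟩ := step a ha hterminal
      obtain ⟨c, hc, hbc, hterminal⟩ := ih (N b) (hn ▸ hlt) hb rfl
      exact ⟨c, hc, .trans _ _ _ hab hbc, hterminal⟩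

/-- The number of occurrences of the letter `b` in a tuple of words. -/
noncomputable def totalCount (w : Fin u → Word) (b : ℤ) : ℕ := ∑ j, (w j).count b

theorem totalCount_pos {b : ℤ} : 0 < totalCount w b ↔ ∃ j k, (w j).letter k = b := by
  simp only [totalCount, Finset.sum_pos_iff, Finset.mem_univ, true_and, count_pos]

theorem coroot_tensorPow_wt {i : ℤ} (hi : i ≠ 0) (w : Fin u → Word) :
    coroot i ((crystal.tensorPow u).wt w) = totalCount w (i - 1) - totalCount w i := by
  rw [tensorPow_wt, coroot_sum, totalCount, totalCount, Nat.cast_sum, Nat.cast_sum,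
    ← Finset.sum_sub_distrib]
  exact Finset.sum_congr rfl fun j _ => coroot_wt hi (w j)

theorem coroot_zero_tensorPow_wt (w : Fin u → Word) :
    coroot 0 ((crystal.tensorPow u).wt w) = totalCount w (-1) + totalCount w 0 := by
  rw [tensorPow_wt, coroot_sum, totalCount, totalCount, Nat.cast_sum, Nat.cast_sum,
    ← Finset.sum_add_distrib]
  exact Finset.sum_congr rfl fun j _ => coroot_zero_wt (w j)

theorem isSeminormal_tensorPow_crystal (u : ℕ) : (crystal.tensorPow u).IsSeminormal :=
  isSeminormal_crystal.tensorPow u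

theorem tensorPow_wt_snd (w : Fin u → Word) (b : ℤ) :
    ((crystal.tensorPow u).wt w).2 b = totalCount w b - if b < 0 then (u : ℤ) else 0 := by
  rw [tensorPow_wt, Prod.snd_sum, Finsupp.finsetSum_apply]
  change ∑ j, (w j).wt.2 b = _
  simp only [wt_snd, Finset.sum_sub_distrib, totalCount, Nat.cast_sum]
  split_ifs <;> simp

theorem totalCount_of_e {i : ℤ} {w' : Fin u → Word} (h : (crystal.tensorPow u).e i w = some w')
    (b : ℤ) : (totalCount w' b : ℤ) =
      totalCount w b + ((if b = i - 1 then 1 else 0) - (if b = i then 1 else 0)) := by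
  have := DFunLike.congr_fun
    (congrArg Prod.snd ((isSeminormal_tensorPow_crystal u).wt_of_e i w w' h)) b
  simp only [Prod.snd_add, Finsupp.add_apply, tensorPow_wt_snd, simpleRoot, root_apply] at this
  omega

theorem totalCount_pos_of_phi_eq_zero {i : ℤ} (hphi : (crystal.tensorPow u).phi i w = 0)
    (h : 0 < totalCount w (i - 1)) : 0 < totalCount w i := by
  rcases eq_or_ne i 0 with rfl | hi
  · have hodd := (isSeminormal_tensorPow_crystal u).odd w
    rw [coroot_zero_tensorPow_wt] at hodd
    rw [zero_sub] at h
    obtain ⟨w', hw'⟩ := (isSeminormal_tensorPow_crystal u).exists_e 0 w (by omega)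
    have hcount := totalCount_of_e hw' 0
    norm_num at hcount
    omega
  · have hstring := (isSeminormal_tensorPow_crystal u).string i hi w
    rw [coroot_tensorPow_wt hi] at hstring
    omega

theorem totalCount_pos_of_phi_eq_zero_of_le {a b : ℤ} (hab : a ≤ b)
    (hphi : ∀ i, a < i → i ≤ b → (crystal.tensorPow u).phi i w = 0) (h : 0 < totalCount w a) :
    0 < totalCount w b := by
  induction b, hab using Int.leInduction with
  | base => exact h
  | succ b hab ih =>
    refine totalCount_pos_of_phi_eq_zero (hphi _ (by omega) le_rfl) ?_
    rw [add_sub_cancel_right]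
    exact ih fun i hi hib => hphi i hi (by omega)

/-- The total number of steps by which the letters of `w` between `-K` and `M` have to be raised
in order that all of them become `M`. -/
noncomputable def defect (K M : ℕ) (w : Fin u → Word) : ℕ :=
  ∑ b ∈ Finset.Icc (-K : ℤ) M, (M - b).toNat * totalCount w b

theorem defect_of_e {K M : ℕ} {i : ℤ} {w' : Fin u → Word}
    (h : (crystal.tensorPow u).e i w = some w') (hK : -K < i) (hM : i ≤ M) :
    defect K M w' = defect K M w + 1 := by
  have hcast (v : Fin u → Word) :
      (defect K M v : ℤ) = ∑ b ∈ Finset.Icc (-K : ℤ) M, (M - b) * (totalCount v b : ℤ) := by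
    rw [defect, Nat.cast_sum]
    refine Finset.sum_congr rfl fun b hb => ?_
    rw [Nat.cast_mul, Int.toNat_of_nonneg (sub_nonneg.2 (Finset.mem_Icc.1 hb).2)]
  rw [← Nat.cast_inj (R := ℤ), Nat.cast_succ, hcast, hcast]
  simp only [totalCount_of_e h, mul_add, mul_sub, Finset.sum_add_distrib, Finset.sum_sub_distrib,
    mul_ite, mul_one, mul_zero, Finset.sum_ite_eq']
  rw [if_pos (Finset.mem_Icc.2 (by omega)), if_pos (Finset.mem_Icc.2 (by omega))]
  ring

/-- The tableaux with letters `\overline{r + 1}` in the rows `r ≥ K`. -/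
def vacuumFrom (K : ℕ) (lam : Fin u → ℤ) : Set (tableaux lam) :=
  {w | ∀ j (k : ℕ), K ≤ k + lam j → (w.1 j).letter k = -(k + 1 + lam j)}

/-- The tableaux in `vacuumFrom K lam` with unbarred letters in the rows `r < K`; forgetting the
rows `r ≥ K`, they are the semistandard tableaux with unbarred letters of a finite shape. -/
def unbarredUpTo (K : ℕ) (lam : Fin u → ℤ) : Set (tableaux lam) :=
  {w ∈ vacuumFrom K lam | ∀ j (k : ℕ), k + lam j < K → 0 ≤ (w.1 j).letter k}

theorem vacuumFrom_mono (lam : Fin u → ℤ) : Monotone (vacuumFrom · lam) :=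
  fun _ _ h _ hw j k hk => hw j k ((Nat.cast_le.2 h).trans hk)

theorem exists_mem_vacuumFrom (w : tableaux lam) : ∃ K, w ∈ vacuumFrom K lam := by
  obtain ⟨N, hN⟩ := Filter.eventually_atTop.1 (Filter.eventually_all.2 w.2.1)
  refine ⟨N + ∑ j, (lam j).toNat, fun j k hk => hN k ?_ j⟩
  have hle := Finset.single_le_sum (f := fun j => (lam j).toNat) (fun _ _ => Nat.zero_le _)
    (Finset.mem_univ j)
  rw [Nat.cast_add] at hk
  omega

/-- The arrows of the crystal graph of `tableaux lam`, without their colours. -/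
def Arrow (v w : tableaux lam) : Prop := ∃ i, (crystal.tensorPow u).f i v = some w.1

section Arrow

variable {K : ℕ} {i : ℤ} {v w : tableaux lam}

theorem exists_e_eq_some (h : 0 < (crystal.tensorPow u).eps i w) :
    ∃ v : tableaux lam, (crystal.tensorPow u).e i w = some v.1 :=
  have ⟨v, hv⟩ := (isSeminormal_tensorPow_crystal u).exists_e i w h
  ⟨⟨v, mem_tableaux_of_e w.2 hv⟩, hv⟩

theorem exists_f_eq_some (h : 0 < (crystal.tensorPow u).phi i w) :
    ∃ v : tableaux lam, (crystal.tensorPow u).f i w = some v.1 :=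
  have ⟨v, hv⟩ := (isSeminormal_tensorPow_crystal u).exists_f i w h
  ⟨⟨v, mem_tableaux_of_f w.2 hv⟩, hv⟩

theorem arrow_of_e (h : (crystal.tensorPow u).e i v = some w.1) : Arrow w v :=
  ⟨i, ((isSeminormal_tensorPow_crystal u).f_iff_e i w v).2 h⟩

theorem mem_vacuumFrom_iff_of_e (hi : -K < i) (h : (crystal.tensorPow u).e i v = some w.1) :
    w ∈ vacuumFrom K lam ↔ v ∈ vacuumFrom K lam := by
  refine forall₃_congr fun j k hk => ?_
  rcases tensorPow_e_factor isSeminormal_crystal h j with he | hj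
  · obtain ⟨l, hl⟩ := eOp_eq_some_iff.1 he
    rcases eq_or_ne k l with rfl | hne
    · rw [hl.source, hl.target]
      omega
    · rw [hl.eq_of_ne k hne]
  · rw [hj]

theorem mem_unbarredUpTo_of_e (hi : 0 < i) (h : (crystal.tensorPow u).e i v = some w.1)
    (hv : v ∈ unbarredUpTo K lam) : w ∈ unbarredUpTo K lam := by
  refine ⟨(mem_vacuumFrom_iff_of_e (by omega) h).2 hv.1, fun j k hk => ?_⟩
  have hletter := hv.2 j k hk
  rcases tensorPow_e_factor isSeminormal_crystal h j with he | hj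
  · obtain ⟨l, hl⟩ := eOp_eq_some_iff.1 he
    rcases eq_or_ne k l with rfl | hne
    · rw [hl.target]
      omega
    · rwa [hl.eq_of_ne k hne]
  · rwa [hj]

theorem lt_sum_of_totalCount_pos {M : ℕ} (hw : w ∈ vacuumFrom K lam)
    (h : ∀ b : ℕ, b ≤ M → 0 < totalCount w.1 b) : M < ∑ j, (K - lam j).toNat := by
  let boxes : Finset (Σ _ : Fin u, ℕ) :=
    Finset.univ.sigma fun j => Finset.range (K - lam j).toNat
  have hsub : (Finset.range (M + 1)).map Nat.castEmbedding ⊆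
      boxes.image fun p => (w.1 p.1).letter p.2 := by
    intro c hc
    obtain ⟨b, hb, rfl⟩ := Finset.mem_map.1 hc
    obtain ⟨j, k, hjk⟩ := totalCount_pos.1 (h b (Finset.mem_range_succ_iff.1 hb))
    have hlt : k < (K - lam j).toNat := by
      by_contra hle
      have hvac := hw j k (by omega)
      rw [hjk] at hvac
      omega
    exact Finset.mem_image.2
      ⟨⟨j, k⟩, Finset.mem_sigma.2 ⟨Finset.mem_univ j, Finset.mem_range.2 hlt⟩, hjk⟩
  have hcard := (Finset.card_le_card hsub).trans Finset.card_image_le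
  rwa [Finset.card_map, Finset.card_range, Finset.card_sigma,
    Finset.sum_congr rfl fun _ _ => Finset.card_range _] at hcard

theorem mem_unbarredUpTo_of_phi_eq_zero (hw : w ∈ vacuumFrom K lam)
    (h : ∀ i, -(K : ℤ) < i → i ≤ ∑ j, (K - lam j).toNat → (crystal.tensorPow u).phi i w = 0) :
    w ∈ unbarredUpTo K lam := by
  refine ⟨hw, fun j k hk => ?_⟩
  by_contra hneg
  have hle := le_letter ((mem_tableaux.1 w.2).1 j) k
  refine (lt_sum_of_totalCount_pos (M := ∑ j, (K - lam j).toNat) hw fun b hb => ?_).false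
  exact totalCount_pos_of_phi_eq_zero_of_le (a := (w.1 j).letter k) (by omega)
    (fun i hi hib => h i (by omega) (by omega)) (totalCount_pos.2 ⟨j, k, rfl⟩)

theorem exists_eqvGen_mem_unbarredUpTo (hw : w ∈ vacuumFrom K lam) :
    ∃ v ∈ unbarredUpTo K lam, Relation.EqvGen Arrow w v := by
  let M := ∑ j, (K - lam j).toNat
  let IsTop (v : tableaux lam) : Prop :=
    ∀ i, -(K : ℤ) < i → i ≤ M → (crystal.tensorPow u).phi i v = 0
  have hstep : ∀ v ∈ vacuumFrom K lam, ¬ IsTop v →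
      ∃ v' ∈ vacuumFrom K lam, Relation.EqvGen Arrow v v' ∧ defect K M v'.1 < defect K M v.1 := by
    intro v hv hphi
    simp only [IsTop] at hphi
    push Not at hphi
    obtain ⟨i, hK, hM, hphi⟩ := hphi
    obtain ⟨v', hf⟩ := exists_f_eq_some (Nat.pos_of_ne_zero hphi)
    have he := ((isSeminormal_tensorPow_crystal u).f_iff_e i v v').1 hf
    exact ⟨v', (mem_vacuumFrom_iff_of_e hK he).1 hv, .rel _ _ ⟨i, hf⟩,
      (Nat.lt_succ_self _).trans_eq (defect_of_e he hK hM).symm⟩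
  obtain ⟨v, hv, hwv, htop⟩ := exists_eqvGen_of_descent _ hstep hw
  exact ⟨v, mem_unbarredUpTo_of_phi_eq_zero hv htop, hwv⟩

theorem exists_least_lt_letter (hlam : Antitone lam) (hw : w ∈ unbarredUpTo K lam)
    (hne : w.1 ≠ least K lam) : ∃ j k, (j.rev : ℤ) < (w.1 j).letter k ∧
      ∀ l, j < l → w.1 l = least K lam l := by
  obtain ⟨j, hj, hmax⟩ := Set.exists_max_image {j | w.1 j ≠ least K lam j} id (Set.toFinite _)
    (Function.ne_iff.1 hne)
  obtain ⟨k, hk⟩ : ∃ k, (w.1 j).letter k ≠ (least K lam j).letter k :=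
    Function.ne_iff.1 fun h => hj (Word.ext h)
  refine ⟨j, k, ?_, fun l hl => by_contra fun hne => (hmax l hne).not_gt hl⟩
  have hle := least_le hlam w.2 hw.2 j k
  rw [least, fill_letter] at hk hle
  split_ifs at hk hle with hkK
  · exact hle.lt_of_ne' hk
  · exact absurd (hw.1 j k (not_lt.1 hkK)) hk

theorem exists_e_of_ne_least (hlam : Antitone lam) (hw : w ∈ unbarredUpTo K lam)
    (hne : w.1 ≠ least K lam) :
    ∃ i > 0, ∃ v : tableaux lam, (crystal.tensorPow u).e i w = some v.1 := by
  obtain ⟨j, k, hlt, hright⟩ := exists_least_lt_letter hlam hw hne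
  have hpos : 0 < (w.1 j).letter k := by omega
  refine ⟨_, hpos, exists_e_eq_some <| tensorPow_eps_pos isSeminormal_crystal hpos (j := j) ?_
    fun l hl => ?_⟩
  · rw [crystal_eps, epsCount, if_neg hpos.not_ge]
    exact count_pos.2 ⟨k, rfl⟩
  · have hcount : (w.1 l).count ((w.1 j).letter k - 1) = 0 := by
      refine count_eq_zero.2 fun m => ?_
      rw [hright l hl, least, fill_letter]
      rw [Fin.lt_def] at hl
      rw [Fin.val_rev] at *
      split_ifs <;> omega
    change coroot _ (w.1 l).wt ≤ 0
    rw [coroot_wt hpos.ne']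
    omega

theorem eqvGen_least (hlam : Antitone lam) (hw : w ∈ unbarredUpTo K lam) :
    Relation.EqvGen Arrow w ⟨least K lam, least_mem_tableaux K hlam⟩ := by
  let wtHeight (v : Fin u → Word) : ℤ := height ((crystal.tensorPow u).wt v)
  have hstep : ∀ v ∈ unbarredUpTo K lam, ¬ v.1 = least K lam →
      ∃ v' ∈ unbarredUpTo K lam, Relation.EqvGen Arrow v v' ∧
        (wtHeight (least K lam) - wtHeight v').toNat <
          (wtHeight (least K lam) - wtHeight v).toNat := by
    intro v hv hne
    obtain ⟨i, hi, v', he⟩ := exists_e_of_ne_least hlam hv hne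
    have hv' := mem_unbarredUpTo_of_e hi he hv
    have hle : wtHeight v' ≤ wtHeight (least K lam) :=
      (weightLE_tensorPow_wt (least_mem_tableaux K hlam) v'.2
        (least_le hlam v'.2 hv'.2)).height_le
    have hsucc : wtHeight v' = wtHeight v + 1 := by
      simp only [wtHeight]
      rw [(isSeminormal_tensorPow_crystal u).wt_of_e i v v' he, map_add, height_simpleRoot]
    exact ⟨v', hv', .symm _ _ (.rel _ _ (arrow_of_e he)), by omega⟩
  obtain ⟨v, -, hwv, heq⟩ := exists_eqvGen_of_descent _ hstep hw
  exact (Subtype.ext heq : v = ⟨_, _⟩) ▸ hwv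

end Arrow

theorem isConnectedOn_tableaux (hlam : Antitone lam) :
    (crystal.tensorPow u).IsConnectedOn (tableaux lam) := by
  refine ⟨⟨_, highest_mem_tableaux hlam⟩, fun w w' => ?_⟩
  obtain ⟨K, hK⟩ := exists_mem_vacuumFrom w
  obtain ⟨L, hL⟩ := exists_mem_vacuumFrom w'
  have hleast {v : tableaux lam} (hv : v ∈ vacuumFrom (max K L) lam) :
      Relation.EqvGen Arrow v ⟨_, least_mem_tableaux (max K L) hlam⟩ := by
    obtain ⟨v', hv', h⟩ := exists_eqvGen_mem_unbarredUpTo hv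
    exact .trans _ _ _ h (eqvGen_least hlam hv')
  exact .trans _ _ _ (hleast (vacuumFrom_mono lam (le_max_left K L) hK))
    (.symm _ _ (hleast (vacuumFrom_mono lam (le_max_right K L) hL)))

end SemiInf

theorem proposition5p2 (u : ℕ) (hu : 1 ≤ u) (lam : Fin u → ℤ) (hlam : Antitone lam) :
    (SemiInf.Word.crystal.tensorPow u).IsStable (SemiInf.tableaux lam) ∧
    (SemiInf.Word.crystal.tensorPow u).IsCrystalOn (SemiInf.tableaux lam) ∧
    (SemiInf.Word.crystal.tensorPow u).IsConnectedOn (SemiInf.tableaux lam) ∧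
    ∀ w : Fin u → SemiInf.Word,
      (SemiInf.Word.crystal.tensorPow u).IsHighestWeight (SemiInf.tableaux lam) w ↔
        w = SemiInf.highest lam := by
  have hstable := SemiInf.isStable_tableaux lam
  exact ⟨hstable, (SemiInf.isSeminormal_tensorPow_crystal u).isCrystalOn hstable,
    SemiInf.isConnectedOn_tableaux hlam, SemiInf.isHighestWeight_iff hlam⟩
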